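/- Let $\mathbb{T}=\mathbb{R}/\mathbb{Z}$, $T>0$, $Q_T=\mathbb{T}\times(0,T)$. For $\tau>0$ set $t_k=k\tau$ and $\mathbf 1_{\mathrm{det}}=\sum_{k\ge 0}\mathbf 1_{[t_{2k},t_{2k+1})}$ (a function of time). Given $u\colon Q_T\to\mathbb{R}$ and $\rho_0\in L^2(\mathbb{T})$, a generalized solution of $$\tfrac12\partial_t\rho+\mathbf 1_{\mathrm{det}}\left[\partial_x(\rho u)-\partial_x^2\rho\right]=0\ \text{ in } Q_T,\qquad \rho(\cdot,0)=\rho_0,$$ is a function $\rho\in C([0,T];L^2(\mathbb{T}))$ with $\mathbf 1_{\mathrm{det}}\rho\in L^2(0,T;H^1(\mathbb{T}))$ such that $$\iint_{Q_T}\Big(\tfrac12\rho\,\partial_t\varphi+\mathbf 1_{\mathrm{det}}[\rho u-\partial_x\rho]\,\partial_x\varphi\Big)\,dx\,dt+\tfrac12\int_{\mathbb{T}}\rho_0(x)\varphi(x,0)\,dx=0$$ for all $\varphi\in L^2(\mathbb{T};H^1(0,T))$ with $\varphi(\cdot,T)=0$ and $\mathbf 1_{\mathrm{det}}\varphi\in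 L^2(0,T;H^1(\mathbb{T}))$. Theorem (Positivity). For all $c_0>0$, $T>0$, $m>6$ and $A,B\in\mathbb{R}$ there exists a constant $c>0$, depending only on $c_0,T,m,A,B$, such that the following holds. Let $\tau>0$, let $u\in L^m(Q_T)$ have a weak derivative $\partial_x u$ in $Q_T$ (that is, $\partial_x u$ is a measurable function on $Q_T$ and, for a.e. $t\in(0,T)$, $u(\cdot,t)\in W^{1,1}(\mathbb{T})$ with weak derivative $\partial_x u(\cdot,t)$), let $\rho_0\in L^2(\mathbb{T})$ satisfy $\rho_0\ge c_0$ a.e. in $\mathbb{T}$, and let $\rho$ be a generalized solution of the problem above. If $\|u\|_{L^m(Q_T)}\le B$, if $\rho|\partial_x u|^2$ is integrable on $Q_T$ and if $$\iint_{Q_T}\rho|\partial_x u|^2\,dx\,dt\le A,$$ then $\rho\ge c$ a.e. in $Q_T$. -/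

import Mathlib

open MeasureTheory Set Filter Topology
open scoped ContDiff

noncomputable section

/-- The one-dimensional torus `ℝ / ℤ`, with its Lebesgue (Haar probability) measure. -/
abbrev Torus : Type := UnitAddCircle

/-- Lebesgue measure on the space-time cylinderMeasure `Q_T = 𝕋 × (0, T)`; points are written `(x, t)`. -/
def cylinderMeasure (T : ℝ) : Measure (Torus × ℝ) :=
  (volume : Measure Torus).prod (volume.restrict (Ioo 0 T))

/-- With `t_k = k τ`, the indicator function of the union over `k ≥ 0` of the intervals
`[t_{2k}, t_{2k+1})`. -/
def oneDet (τ : ℝ) : ℝ → ℝ :=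
  indicator (⋃ k : ℕ, Ico ((2 * (k : ℝ)) * τ) ((2 * (k : ℝ) + 1) * τ)) 1

/-- The classical derivative at `x` of a function on the torus. -/
def torusDeriv (φ : Torus → ℝ) (x : Torus) : ℝ :=
  deriv (fun s : ℝ => φ (x + (s : Torus))) 0

/-- `φ ∈ C^∞(𝕋)`: the associated periodic function on the real line is smooth. -/
def TorusSmooth (φ : Torus → ℝ) : Prop :=
  ContDiff ℝ ∞ (fun s : ℝ => φ (s : Torus))

/-- `f ∈ W^{1,1}(𝕋)` with weak derivative `g`. -/
def HasWeakDeriv (f g : Torus → ℝ) : Prop :=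
  Integrable f volume ∧ Integrable g volume ∧
    ∀ φ : Torus → ℝ, TorusSmooth φ → ∫ x, f x * torusDeriv φ x = - ∫ x, g x * φ x

/-- `g` is the weak derivative `∂_x f` of `f` on `Q_T` with respect to the space variable:
for almost every time `t ∈ (0, T)`, `g(·, t)` is the weak derivative of `f(·, t)`. -/
def HasWeakDerivX (T : ℝ) (f g : Torus × ℝ → ℝ) : Prop :=
  ∀ᵐ t ∂(volume.restrict (Ioo 0 T)), HasWeakDeriv (fun x => f (x, t)) (fun x => g (x, t))

/-- `f ∈ L²(0, T; H¹(𝕋))`, with `∂_x f = g`. -/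
def MemL2H1 (T : ℝ) (f g : Torus × ℝ → ℝ) : Prop :=
  MemLp f 2 (cylinderMeasure T) ∧ MemLp g 2 (cylinderMeasure T) ∧ HasWeakDerivX T f g

/-- `φ ∈ L²(𝕋; H¹(0, T))`, with `∂_t φ = φt`; `φ` is the representative for which
`φ(x, ·)` is absolutely continuous on `[0, T]` for a.e. `x`, so that the values of `φ(x, ·)`
at the end-points `0` and `T` are the traces. -/
def MemL2H1Time (T : ℝ) (φ φt : Torus × ℝ → ℝ) : Prop :=
  MemLp φ 2 (cylinderMeasure T) ∧ MemLp φt 2 (cylinderMeasure T) ∧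
    ∀ᵐ x : Torus, ∀ t ∈ Icc 0 T, φ (x, t) = φ (x, 0) + ∫ s in (0 : ℝ)..t, φt (x, s)

/-- `ρ ∈ C([0, T]; L²(𝕋))`, as a function which is measurable on `Q_T`, whose restriction at
every time `t ∈ [0, T]` is in `L²(𝕋)`, and depends continuously on `t` for the `L²`-norm. -/
def MemCL2 (T : ℝ) (ρ : Torus × ℝ → ℝ) : Prop :=
  AEStronglyMeasurable ρ (cylinderMeasure T) ∧
    (∀ t ∈ Icc 0 T, MemLp (fun x => ρ (x, t)) 2 volume) ∧
    ∀ t ∈ Icc 0 T,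
      Tendsto (fun s => eLpNorm (fun x => ρ (x, s) - ρ (x, t)) 2 volume) (𝓝[Icc 0 T] t) (𝓝 0)

/-- The admissible test functions: `φ ∈ L²(𝕋; H¹(0, T))` with `φ(·, T) = 0` and
`1_det φ ∈ L²(0, T; H¹(𝕋))`, with `φt = ∂_t φ` and `φx = ∂_x (1_det φ) = 1_det ∂_x φ`. -/
def IsTestFunction (T τ : ℝ) (φ φt φx : Torus × ℝ → ℝ) : Prop :=
  MemL2H1Time T φ φt ∧ (∀ᵐ x : Torus, φ (x, T) = 0) ∧
    MemL2H1 T (fun z => oneDet τ z.2 * φ z) φx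

/-- `ρ` is a generalized solution on `Q_T` of
`(1/2) ∂_t ρ + 1_det [∂_x (ρ u) - ∂_x² ρ] = 0`, `ρ(·, 0) = ρ₀`.
Here `ρx = ∂_x (1_det ρ) = 1_det ∂_x ρ`. -/
def IsGeneralizedSolution (T τ : ℝ) (u : Torus × ℝ → ℝ) (ρ₀ : Torus → ℝ)
    (ρ : Torus × ℝ → ℝ) : Prop :=
  MemCL2 T ρ ∧
    ∃ ρx : Torus × ℝ → ℝ, MemL2H1 T (fun z => oneDet τ z.2 * ρ z) ρx ∧
      ∀ φ φt φx : Torus × ℝ → ℝ, IsTestFunction T τ φ φt φx →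
        (∫ z, ((1 / 2 : ℝ) * (ρ z * φt z) + oneDet τ z.2 * ((ρ z * u z - ρx z) * φx z))
            ∂(cylinderMeasure T))
          + (1 / 2 : ℝ) * ∫ x : Torus, ρ₀ x * φ (x, 0) = 0

end

/-! The bound is a De Giorgi iteration on `-log ρ`. Testing the equation with `F'(ρ)`, `F` convex,
and using `2 ρx (ρ u - ρx) ≤ (ρ u)² - ρx²` gives `∫ F(ρ(t)) + ∬ 1_det F''(ρ) ρx² ≤ ∫ F(ρ₀) + ∬ 1_det
F''(ρ) (ρ u)²`. The switch `1_det` multiplies only the spatial terms, so `τ` enters no constant.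

A smooth approximation of the negative part has `F''(r) r² = O(ε)`; letting `ε → 0` yields `ρ ≥ 0`
(`IsRegularSolution.ae_nonneg`).

Next take `F = v³ / 3` with `v = (- log (ρ + δ) - k)₊`. The weight `(ρ + δ)⁻²` in `F''` absorbs the
factor `ρ²` of the drift term, and the initial term vanishes for `k ≥ - log c₀`. Hence `sup_t ∫ v³`
and the dissipation are controlled by `P(k) = ∬ 1_det u² w²`, where `w = 1 + v` on `{v > 0}` and `w
= 0` elsewhere (`entropy_estimates`). The one-dimensional Sobolev inequality for `v³` gives `∬ 1_det
v⁶ ≤ C P(k)²`. Hölder with `∬ u⁶ ≤ U` gives `P³ ≤ U Z²`, where `Z(k) = ∬ 1_det w³`. Where the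
truncation at a level `h > k` is positive, the one at level `k` exceeds `h - k`, so `Z(h)` is
bounded by `∬ 1_det v⁶` at level `k`. Altogether `Z(h)³ ≤ C(h - k) Z(k)⁴`: the exponent `4/3`
exceeds one, and `Z` vanishes at a finite level (`exists_vanishing_level`) that is independent of
`δ` and `τ`. Then `P = 0` there, so `v = 0` at every time, and `δ → 0` gives the bound.

The entropy computation is justified by mollifying in space only (`energy_identity`): the mollified
density is absolutely continuous in time, which permits the chain rule, and the limit is taken
afterwards. The flux is square integrable because `1_det ρ ∈ L⁴` (`memLp_four_oneDet_mul`). -/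

noncomputable section

/-! ### Differential calculus on the circle -/

/-- `φ'` is the classical derivative of the function `φ` on the torus. -/
def HasTorusDeriv (φ φ' : Torus → ℝ) : Prop :=
  ∀ x, HasDerivAt (fun s : ℝ => φ (x + (s : Torus))) (φ' x) 0

namespace HasTorusDeriv

variable {φ φ' ψ ψ' : Torus → ℝ}

theorem hasDerivAt (h : HasTorusDeriv φ φ') (x : Torus) (s₀ : ℝ) :
    HasDerivAt (fun s : ℝ => φ (x + (s : Torus))) (φ' (x + (s₀ : Torus))) s₀ := by
  have h1 := h (x + (s₀ : Torus))
  have h1' : HasDerivAt (fun s : ℝ => φ (x + (s₀ : Torus) + (s : Torus))) (φ' (x + (s₀ : Torus)))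
      (s₀ - s₀) := by simpa using h1
  have h3 := h1'.comp_sub_const s₀ s₀
  refine h3.congr_of_eventuallyEq (Eventually.of_forall fun s => ?_)
  simp only [AddCircle.coe_sub]
  congr 1
  abel

theorem torusDeriv_eq (h : HasTorusDeriv φ φ') : torusDeriv φ = φ' :=
  funext fun x => (h x).deriv

theorem comp (h : HasTorusDeriv φ φ') {F F' : ℝ → ℝ}
    (hF : ∀ x, HasDerivAt F (F' (φ x)) (φ x)) :
    HasTorusDeriv (fun x => F (φ x)) (fun x => F' (φ x) * φ' x) := fun x => by
  have h1 := hF x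
  have : φ x = φ (x + ((0 : ℝ) : Torus)) := by simp
  rw [this] at h1
  have h2 := HasDerivAt.comp (0 : ℝ) h1 (h x)
  simpa [Function.comp_def] using h2

theorem mul (h : HasTorusDeriv φ φ') (k : HasTorusDeriv ψ ψ') :
    HasTorusDeriv (fun x => φ x * ψ x) (fun x => φ' x * ψ x + φ x * ψ' x) := fun x => by
  have h1 := (h x).mul (k x)
  simp only [AddCircle.coe_zero, add_zero] at h1
  exact h1

theorem intervalIntegral_eq (h : HasTorusDeriv φ φ') (hc : Continuous φ') (x : Torus) (a b : ℝ) :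
    ∫ s in a..b, φ' (x + (s : Torus)) = φ (x + (b : Torus)) - φ (x + (a : Torus)) :=
  intervalIntegral.integral_eq_sub_of_hasDerivAt (fun s _ => h.hasDerivAt x s)
    ((hc.comp (continuous_const.add (AddCircle.continuous_mk' _))).intervalIntegrable _ _)

end HasTorusDeriv

theorem torus_intervalIntegral_add (f : Torus → ℝ) (x : Torus) :
    ∫ s in (0 : ℝ)..1, f (x + (s : Torus)) = ∫ y, f y := by
  have := UnitAddCircle.intervalIntegral_preimage 0 (fun y => f (x + y))
  rw [zero_add] at this
  rw [this, integral_add_left_eq_self]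

namespace HasTorusDeriv

variable {φ φ' ψ ψ' : Torus → ℝ}

theorem integral_eq_zero (h : HasTorusDeriv φ φ') (hc : Continuous φ') : ∫ x, φ' x = 0 := by
  rw [← torus_intervalIntegral_add φ' 0, h.intervalIntegral_eq hc]
  have : ((1 : ℝ) : Torus) = 0 := AddCircle.coe_period 1
  simp [this]

theorem continuous (h : HasTorusDeriv φ φ') : Continuous φ := by
  have h1 : Continuous (fun s : ℝ => φ (s : Torus)) := by
    refine continuous_iff_continuousAt.2 fun s => ?_
    simpa using (h.hasDerivAt 0 s).continuousAt
  exact (QuotientAddGroup.isQuotientMap_mk _).continuous_iff.2 h1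

theorem integral_mul_eq (h : HasTorusDeriv φ φ') (k : HasTorusDeriv ψ ψ')
    (hc : Continuous φ') (kc : Continuous ψ') :
    ∫ x, φ x * ψ' x = - ∫ x, φ' x * ψ x := by
  have hφ := h.continuous
  have hψ := k.continuous
  have h1 := (h.mul k).integral_eq_zero (by fun_prop)
  rw [integral_add ((by fun_prop : Continuous _).integrable_of_hasCompactSupport
      (HasCompactSupport.of_compactSpace _))
    ((by fun_prop : Continuous _).integrable_of_hasCompactSupport
      (HasCompactSupport.of_compactSpace _))] at h1
  linarith

/-- By the fundamental theorem of calculus `|φ x|` and `|φ (x + s)|` differ by at most `∫ |φ'|`;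
averaging over `s` in one period replaces the second by `∫ |φ|`. -/
theorem abs_le (h : HasTorusDeriv φ φ') (hc : Continuous φ') (x : Torus) :
    |φ x| ≤ (∫ y, |φ y|) + ∫ y, |φ' y| := by
  have hφ := h.continuous
  have hmk : Continuous (fun s : ℝ => (s : Torus)) := AddCircle.continuous_mk' _
  have key : ∀ s ∈ Icc (0 : ℝ) 1, |φ x| ≤ |φ (x + (s : Torus))| + ∫ y, |φ' y| := by
    intro s hs
    have h1 := h.intervalIntegral_eq hc x 0 s
    simp only [AddCircle.coe_zero, add_zero] at h1
    have hi : ∀ a b : ℝ, IntervalIntegrable (fun r : ℝ => |φ' (x + (r : Torus))|) volume a b :=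
      fun a b => (by fun_prop : Continuous _).intervalIntegrable _ _
    have h2 : |φ (x + (s : Torus)) - φ x| ≤ ∫ y, |φ' y| := by
      rw [← h1, ← torus_intervalIntegral_add (fun y => |φ' y|) x]
      refine (intervalIntegral.abs_integral_le_integral_abs hs.1).trans ?_
      exact intervalIntegral.integral_mono_interval le_rfl hs.1 hs.2
        (Eventually.of_forall fun _ => abs_nonneg _) (hi _ _)
    have h3 := abs_sub_abs_le_abs_sub (φ x) (φ (x + (s : Torus)))
    rw [abs_sub_comm] at h3
    linarith
  have h4 := intervalIntegral.integral_mono_on (μ := volume) (zero_le_one (α := ℝ))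
    (by simp : IntervalIntegrable (fun _ : ℝ => |φ x|) volume 0 1)
    ((by fun_prop : Continuous (fun s : ℝ => |φ (x + (s : Torus))| + ∫ y, |φ' y|)).intervalIntegrable
      _ _) key
  rw [intervalIntegral.integral_add ((by fun_prop : Continuous _).intervalIntegrable _ _) (by simp),
    torus_intervalIntegral_add (fun y => |φ y|) x] at h4
  simpa using h4

end HasTorusDeriv

namespace TorusSmooth

variable {ψ : Torus → ℝ}

theorem continuous (h : TorusSmooth ψ) : Continuous ψ :=
  (QuotientAddGroup.isQuotientMap_mk _).continuous_iff.2 (ContDiff.continuous h)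

theorem deriv_add (h : TorusSmooth ψ) (a : ℝ) :
    HasDerivAt (fun s : ℝ => ψ ((a : Torus) + (s : Torus))) (deriv (fun s : ℝ => ψ s) a) 0 := by
  have h1 : HasDerivAt (fun s : ℝ => ψ s) (deriv (fun s : ℝ => ψ s) a) (a + 0) := by
    rw [add_zero]
    exact ((ContDiff.differentiable h (by simp)) a).hasDerivAt
  have h2 := h1.comp_const_add a 0
  simpa using h2

theorem hasTorusDeriv (h : TorusSmooth ψ) : HasTorusDeriv ψ (torusDeriv ψ) := fun x => by
  obtain ⟨a, rfl⟩ := QuotientAddGroup.mk_surjective x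
  exact (h.deriv_add a).differentiableAt.hasDerivAt

theorem continuous_torusDeriv (h : TorusSmooth ψ) : Continuous (torusDeriv ψ) := by
  refine (QuotientAddGroup.isQuotientMap_mk _).continuous_iff.2 ?_
  have : (torusDeriv ψ ∘ fun a : ℝ => (a : Torus)) = deriv (fun s : ℝ => ψ s) :=
    funext fun a => (h.deriv_add a).deriv
  change Continuous (torusDeriv ψ ∘ fun a : ℝ => (a : Torus))
  rw [this]
  exact ContDiff.continuous_deriv h (by simp)

theorem comp_const_sub (h : TorusSmooth ψ) (x : Torus) : TorusSmooth (fun y => ψ (x - y)) := by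
  obtain ⟨a, rfl⟩ := QuotientAddGroup.mk_surjective x
  have h1 : ContDiff ℝ ∞ (fun s : ℝ => (fun s : ℝ => ψ s) (a - s)) :=
    ContDiff.comp (g := fun s : ℝ => ψ s) h (contDiff_const.sub contDiff_id)
  exact h1

theorem torusDeriv_comp_const_sub (h : TorusSmooth ψ) (x : Torus) :
    torusDeriv (fun y => ψ (x - y)) = fun y => - torusDeriv ψ (x - y) := by
  refine HasTorusDeriv.torusDeriv_eq fun y => ?_
  have h1 := h.hasTorusDeriv (x - y)
  rw [← neg_zero] at h1
  have h2 := HasDerivAt.comp (0 : ℝ) h1 (hasDerivAt_neg 0)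
  rw [mul_neg_one] at h2
  refine h2.congr_of_eventuallyEq (Eventually.of_forall fun s => ?_)
  simp only [Function.comp_apply, AddCircle.coe_neg]
  congr 1
  abel

end TorusSmooth

/-! ### Convolution with a smooth kernel -/

/-- Convolution on the torus. -/
def torusConv (k f : Torus → ℝ) (x : Torus) : ℝ := ∫ y, k (x - y) * f y

section Convolution

variable {k f g : Torus → ℝ}

theorem Continuous.exists_abs_le_torus (hk : Continuous k) : ∃ C, 0 ≤ C ∧ ∀ x, |k x| ≤ C := by
  obtain ⟨C, hC⟩ := isCompact_univ.exists_bound_of_continuousOn hk.continuousOn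
  exact ⟨C, (norm_nonneg _).trans (hC 0 (mem_univ _)), fun x => hC x (mem_univ _)⟩

theorem integrable_conv_kernel (hk : Continuous k) (hf : Integrable f volume) (x : Torus) :
    Integrable (fun y => k (x - y) * f y) volume := by
  obtain ⟨C, -, hC⟩ := hk.exists_abs_le_torus
  exact hf.bdd_mul (by fun_prop) (Eventually.of_forall fun y => hC (x - y))

theorem abs_torusConv_le {C : ℝ} (hC : ∀ x, |k x| ≤ C) (hf : Integrable f volume) (x : Torus) :
    |torusConv k f x| ≤ C * ∫ y, |f y| := by
  rw [← integral_const_mul]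
  change ‖∫ y, k (x - y) * f y‖ ≤ _
  refine norm_integral_le_of_norm_le (hf.abs.const_mul C) (Eventually.of_forall fun y => ?_)
  rw [Real.norm_eq_abs, abs_mul]
  exact mul_le_mul_of_nonneg_right (hC _) (abs_nonneg _)

theorem continuous_torusConv (hk : Continuous k) (hf : Integrable f volume) :
    Continuous (torusConv k f) := by
  obtain ⟨C, -, hC⟩ := hk.exists_abs_le_torus
  change Continuous fun x => ∫ y, k (x - y) * f y
  refine continuous_of_dominated (bound := fun y => C * |f y|) (fun x => ?_) (fun x => ?_)
    (hf.abs.const_mul C) (Eventually.of_forall fun y => by fun_prop)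
  · exact (integrable_conv_kernel hk hf x).aestronglyMeasurable
  · refine Eventually.of_forall fun y => ?_
    rw [Real.norm_eq_abs, abs_mul]
    exact mul_le_mul_of_nonneg_right (hC _) (abs_nonneg _)

theorem hasTorusDeriv_torusConv (hk : TorusSmooth k) (hf : Integrable f volume) :
    HasTorusDeriv (torusConv k f) (torusConv (torusDeriv k) f) := fun x => by
  obtain ⟨C, -, hC⟩ := hk.continuous_torusDeriv.exists_abs_le_torus
  have hkc := hk.continuous
  have hkd := hk.continuous_torusDeriv
  have := hasDerivAt_integral_of_dominated_loc_of_deriv_le (𝕜 := ℝ) (μ := (volume : Measure Torus))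
    (F := fun (s : ℝ) y => k (x + (s : Torus) - y) * f y)
    (F' := fun (s : ℝ) y => torusDeriv k (x + (s : Torus) - y) * f y) (x₀ := 0)
    (bound := fun y => C * |f y|) (Filter.univ_mem)
    (Eventually.of_forall fun s => (integrable_conv_kernel hkc hf _).aestronglyMeasurable)
    (integrable_conv_kernel hkc hf _)
    (integrable_conv_kernel hkd hf _).aestronglyMeasurable
    (Eventually.of_forall fun y s _ => by
      rw [Real.norm_eq_abs, abs_mul]
      exact mul_le_mul_of_nonneg_right (hC _) (abs_nonneg _))
    (hf.abs.const_mul C)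
    (Eventually.of_forall fun y s _ => by
      have h1 := (hk.hasTorusDeriv.hasDerivAt (x - y) s).mul_const (f y)
      have h2 : ∀ s : ℝ, x - y + (s : Torus) = x + (s : Torus) - y := fun s => by abel
      simpa only [h2] using h1)
  have h3 := this.2
  simp only [AddCircle.coe_zero, add_zero] at h3
  exact h3

/-- The reflected translate `y ↦ k (x - y)` is an admissible test function; its sign change under
differentiation cancels the sign of the weak derivative. -/
theorem HasWeakDeriv.torusConv_torusDeriv (h : HasWeakDeriv f g) (hk : TorusSmooth k) :
    torusConv (torusDeriv k) f = torusConv k g := funext fun x => by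
  have h1 := h.2.2 _ (hk.comp_const_sub x)
  rw [hk.torusDeriv_comp_const_sub x] at h1
  simp only [mul_neg, integral_neg, neg_inj] at h1
  simp only [torusConv]
  rw [show (fun y => torusDeriv k (x - y) * f y) = fun y => f y * torusDeriv k (x - y) from
    funext fun y => mul_comm _ _, h1]
  exact integral_congr_ae (Eventually.of_forall fun y => mul_comm _ _)

end Convolution

/-! ### A smooth approximate identity: normalised powers of a cosine bump -/

instance isProbabilityMeasure_torus : IsProbabilityMeasure (volume : Measure Torus) :=
  ⟨UnitAddCircle.measure_univ⟩

/-- The function `(1 + cos (2 π x)) / 2` on the torus. -/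
def cosBump (x : Torus) : ℝ := (1 + (fourier 1 x : ℂ).re) / 2

theorem cosBump_coe (s : ℝ) : cosBump (s : Torus) = (1 + Real.cos (2 * Real.pi * s)) / 2 := by
  rw [cosBump, fourier_coe_apply]
  congr 2
  rw [← Complex.exp_ofReal_mul_I_re]
  congr 2
  push_cast
  ring

theorem continuous_cosBump : Continuous cosBump := by
  unfold cosBump
  fun_prop

theorem cosBump_nonneg (x : Torus) : 0 ≤ cosBump x := by
  obtain ⟨s, rfl⟩ := QuotientAddGroup.mk_surjective x
  have := cosBump_coe s
  have h := Real.neg_one_le_cos (2 * Real.pi * s)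
  change 0 ≤ cosBump (s : Torus)
  linarith

theorem cosBump_zero : cosBump 0 = 1 := by
  have := cosBump_coe 0
  simpa using this

theorem cosBump_lt_one {x : Torus} (hx : x ≠ 0) : cosBump x < 1 := by
  obtain ⟨s, rfl⟩ := QuotientAddGroup.mk_surjective x
  have h1 := cosBump_coe s
  have h2 := Real.cos_le_one (2 * Real.pi * s)
  have h3 : Real.cos (2 * Real.pi * s) ≠ 1 := by
    intro h
    obtain ⟨n, hn⟩ := (Real.cos_eq_one_iff _).1 h
    have h4 : s = n := by
      have := Real.pi_pos
      have h5 : (2 * Real.pi) * (s - n) = 0 := by linarith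
      rcases mul_eq_zero.1 h5 with h6 | h6
      · linarith
      · linarith
    apply hx
    rw [h4]
    exact (AddCircle.coe_eq_zero_iff 1).2 ⟨n, by simp⟩
  have := lt_of_le_of_ne h2 h3
  linarith

theorem torus_integrable_of_continuous {f : Torus → ℝ} (hf : Continuous f) : Integrable f volume :=
  hf.integrable_of_hasCompactSupport (HasCompactSupport.of_compactSpace _)

theorem integral_cosBump_pow_pos (n : ℕ) : 0 < ∫ x, cosBump x ^ n := by
  have hc := continuous_cosBump
  exact (by fun_prop : Continuous fun x => cosBump x ^ n).integral_pos_of_hasCompactSupport_nonneg_nonzero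
    (HasCompactSupport.of_compactSpace _) (fun x => pow_nonneg (cosBump_nonneg x) n)
    (x := 0) (by simp [cosBump_zero])

/-- An approximate identity on the torus. -/
def torusKernel (n : ℕ) (x : Torus) : ℝ := (∫ y, cosBump y ^ n)⁻¹ * cosBump x ^ n

theorem torusKernel_nonneg (n : ℕ) (x : Torus) : 0 ≤ torusKernel n x :=
  mul_nonneg (inv_nonneg.2 (integral_cosBump_pow_pos n).le) (pow_nonneg (cosBump_nonneg x) n)

theorem integral_torusKernel (n : ℕ) : ∫ x, torusKernel n x = 1 := by
  unfold torusKernel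
  rw [integral_const_mul, inv_mul_cancel₀ (integral_cosBump_pow_pos n).ne']

theorem torusSmooth_torusKernel (n : ℕ) : TorusSmooth (torusKernel n) := by
  unfold TorusSmooth torusKernel
  simp only [cosBump_coe]
  fun_prop

theorem continuous_torusKernel (n : ℕ) : Continuous (torusKernel n) :=
  (torusSmooth_torusKernel n).continuous

/-- `cosBump` attains its maximum only at `0`, so the mass of its normalised powers concentrates
there. -/
theorem tendsto_integral_torusKernel_mul {g : Torus → ℝ} (hg : Continuous g) :
    Tendsto (fun n => ∫ x, torusKernel n x * g x) atTop (𝓝 (g 0)) := by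
  have h := tendsto_setIntegral_pow_smul_of_unique_maximum_of_isCompact_of_continuousOn
    (μ := (volume : Measure Torus)) (s := univ) (x₀ := 0) (g := g) isCompact_univ
    continuous_cosBump.continuousOn
    (fun y _ hy => by rw [cosBump_zero]; exact cosBump_lt_one hy) (fun x _ => cosBump_nonneg x)
    (by rw [cosBump_zero]; exact one_pos) (by simp) hg.continuousOn
  refine h.congr fun n => ?_
  simp only [Measure.restrict_univ, smul_eq_mul, torusKernel, mul_assoc]
  rw [integral_const_mul]

/-! ### Mollification in `L²` -/

theorem sq_integral_kernel_mul_le {k h : Torus → ℝ} (hk : Continuous k) (hk0 : ∀ x, 0 ≤ k x)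
    (hk1 : ∫ x, k x = 1) (hh : MemLp h 2 volume) :
    (∫ x, k x * h x) ^ 2 ≤ ∫ x, k x * h x ^ 2 := by
  obtain ⟨C, -, hC⟩ := hk.exists_abs_le_torus
  have i0 := torus_integrable_of_continuous hk
  have i1 : Integrable (fun x => k x * h x) volume :=
    (hh.integrable (by norm_num)).bdd_mul hk.aestronglyMeasurable (Eventually.of_forall hC)
  have i2 : Integrable (fun x => k x * h x ^ 2) volume :=
    hh.integrable_sq.bdd_mul hk.aestronglyMeasurable (Eventually.of_forall hC)
  set m := ∫ x, k x * h x
  -- Jensen's inequality, as nonnegativity of the variance for the probability density `k`.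
  have h1 : 0 ≤ ∫ x, k x * (h x - m) ^ 2 :=
    integral_nonneg fun x => mul_nonneg (hk0 x) (sq_nonneg _)
  have h2 : ∀ x, k x * (h x - m) ^ 2 = k x * h x ^ 2 - 2 * m * (k x * h x) + m ^ 2 * k x :=
    fun x => by ring
  have i3 : Integrable (fun x => k x * h x ^ 2 - 2 * m * (k x * h x)) volume :=
    i2.sub (i1.const_mul _)
  simp only [h2] at h1
  rw [integral_add i3 (i0.const_mul _), integral_sub i2 (i1.const_mul _),
    integral_const_mul, integral_const_mul, hk1] at h1
  change 0 ≤ _ - 2 * m * m + _ at h1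
  nlinarith

theorem torusConv_eq (k f : Torus → ℝ) (x : Torus) : torusConv k f x = ∫ y, k y * f (x - y) := by
  rw [torusConv, ← integral_sub_left_eq_self (fun y => k y * f (x - y)) _ x]
  simp

theorem memLp_comp_const_sub {f : Torus → ℝ} {p : ENNReal} (hf : MemLp f p volume) (x : Torus) :
    MemLp (fun y => f (x - y)) p volume :=
  hf.comp_measurePreserving (Measure.measurePreserving_sub_left volume x)

theorem memLp_comp_sub_const {f : Torus → ℝ} {p : ENNReal} (hf : MemLp f p volume) (y : Torus) :
    MemLp (fun x => f (x - y)) p volume :=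
  hf.comp_measurePreserving (measurePreserving_sub_right volume y)

/-- The `L²` distance of a mollification of `f` to `c f` in terms of the translates of `f`. -/
theorem integral_sq_torusConv_sub_le {k f : Torus → ℝ} (hk : Continuous k) (hk0 : ∀ x, 0 ≤ k x)
    (hk1 : ∫ x, k x = 1) (hf : MemLp f 2 volume) (c : ℝ) :
    ∫ x, (torusConv k f x - c * f x) ^ 2 ≤ ∫ y, k y * ∫ x, (f (x - y) - c * f x) ^ 2 := by
  obtain ⟨C, -, hC⟩ := hk.exists_abs_le_torus
  have hI : Integrable (fun z : Torus × Torus => (f (z.1 - z.2) - c * f z.1) ^ 2)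
      (volume.prod volume) := by
    have h1 : MeasurePreserving (fun z : Torus × Torus => z.1 - z.2) (volume.prod volume) volume :=
      measurePreserving_fst.comp (measurePreserving_sub_prod volume volume)
    exact ((hf.comp_measurePreserving h1).sub
      ((hf.comp_measurePreserving measurePreserving_fst).const_mul c)).integrable_sq
  have hI2 : Integrable (fun z : Torus × Torus => k z.2 * (f (z.1 - z.2) - c * f z.1) ^ 2)
      (volume.prod volume) :=
    hI.bdd_mul (by fun_prop) (Eventually.of_forall fun z => hC z.2)
  calc ∫ x, (torusConv k f x - c * f x) ^ 2
      = ∫ x, (∫ y, k y * (f (x - y) - c * f x)) ^ 2 := by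
        refine integral_congr_ae (Eventually.of_forall fun x => ?_)
        dsimp only
        congr 1
        have i1 : Integrable (fun y => k y * f (x - y)) volume :=
          ((memLp_comp_const_sub hf x).integrable (by norm_num)).bdd_mul hk.aestronglyMeasurable
            (Eventually.of_forall hC)
        simp only [mul_sub]
        rw [integral_sub i1 ((torus_integrable_of_continuous hk).mul_const _), integral_mul_const,
          hk1, one_mul, torusConv_eq]
    _ ≤ ∫ x, ∫ y, k y * (f (x - y) - c * f x) ^ 2 := by
        refine integral_mono_of_nonneg (Eventually.of_forall fun x => sq_nonneg _)
          hI2.integral_prod_left (Eventually.of_forall fun x => ?_)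
        exact sq_integral_kernel_mul_le hk hk0 hk1 ((memLp_comp_const_sub hf x).sub (memLp_const _))
    _ = ∫ y, ∫ x, k y * (f (x - y) - c * f x) ^ 2 := integral_integral_swap hI2
    _ = _ := by simp only [integral_const_mul]

/-- The case `c = 0` of the preceding inequality: by translation invariance the inner integral does
not depend on `y`. -/
theorem integral_sq_torusConv_le {k f : Torus → ℝ} (hk : Continuous k) (hk0 : ∀ x, 0 ≤ k x)
    (hk1 : ∫ x, k x = 1) (hf : MemLp f 2 volume) :
    ∫ x, torusConv k f x ^ 2 ≤ ∫ x, f x ^ 2 := by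
  have h := integral_sq_torusConv_sub_le hk hk0 hk1 hf 0
  simp only [zero_mul, sub_zero] at h
  refine h.trans_eq ?_
  have : ∀ y, ∫ x, f (x - y) ^ 2 = ∫ x, f x ^ 2 :=
    fun y => integral_sub_right_eq_self (fun x => f x ^ 2) y
  simp only [this]
  rw [integral_mul_const, hk1, one_mul]

theorem integral_sq_eq_norm_sq {α : Type*} [MeasurableSpace α] {μ : Measure α} {f : α → ℝ}
    (hf : MemLp f 2 μ) : ∫ x, f x ^ 2 ∂μ = ‖hf.toLp f‖ ^ 2 := by
  rw [Lp.norm_toLp, hf.eLpNorm_eq_integral_rpow_norm (by norm_num) (by norm_num)]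
  rw [ENNReal.toReal_ofReal (by positivity)]
  simp only [ENNReal.toReal_ofNat, Real.rpow_two, Real.norm_eq_abs, sq_abs]
  rw [← Real.rpow_natCast, ← Real.rpow_mul (integral_nonneg fun x => sq_nonneg _)]
  norm_num

/-- Translations act continuously on `L²`, so the square of the norm of a translate minus the
function is continuous in the shift. -/
theorem continuous_integral_sq_translate {f : Torus → ℝ} (hf : MemLp f 2 volume) :
    Continuous (fun y : Torus => ∫ x, (f (x - y) - f x) ^ 2) := by
  have h1 : Continuous fun y : Torus =>
      (DomAddAct.mk (-y) +ᵥ hf.toLp f) - hf.toLp f := by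
    have : Fact ((2 : ENNReal) ≠ ⊤) := ⟨by norm_num⟩
    have h0 : Continuous fun y : Torus => DomAddAct.mk (-y) :=
      (DomAddAct.continuous_mk (M := Torus)).comp continuous_neg
    have h5 : Continuous fun y : Torus => DomAddAct.mk (-y) +ᵥ (hf.toLp f) :=
      continuous_vadd.comp (h0.prodMk continuous_const)
    exact h5.sub continuous_const
  refine (h1.norm.pow 2).congr fun y => ?_
  have h3 : (DomAddAct.mk (-y) +ᵥ hf.toLp f) - hf.toLp f
      = ((memLp_comp_sub_const hf y).sub hf).toLp _ := by
    have h4 : (DomAddAct.mk (-y)) +ᵥ (hf.toLp f) = (memLp_comp_sub_const hf y).toLp _ := by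
      refine (DomAddAct.mk_vadd_toLp (-y) hf).trans
        (MemLp.toLp_congr _ _ (Eventually.of_forall fun x => ?_))
      simp only [vadd_eq_add]
      congr 1
      abel
    rw [MemLp.toLp_sub (memLp_comp_sub_const hf y) hf, h4]
  rw [Pi.pow_apply, h3, ← integral_sq_eq_norm_sq]
  rfl

theorem tendsto_torusConv {f : Torus → ℝ} (hf : MemLp f 2 volume) :
    Tendsto (fun n => ∫ x, (torusConv (torusKernel n) f x - f x) ^ 2) atTop (𝓝 0) := by
  have h1 := tendsto_integral_torusKernel_mul (continuous_integral_sq_translate hf)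
  simp only [sub_zero, sub_self] at h1
  refine tendsto_of_tendsto_of_tendsto_of_le_of_le tendsto_const_nhds (by simpa using h1)
    (fun n => integral_nonneg fun x => sq_nonneg _) fun n => ?_
  have := integral_sq_torusConv_sub_le (continuous_torusKernel n) (torusKernel_nonneg n)
    (integral_torusKernel n) hf 1
  simpa only [one_mul] using this

theorem memLp_of_continuous_torus {f : Torus → ℝ} (hf : Continuous f) (p : ENNReal) :
    MemLp f p volume := by
  obtain ⟨C, -, hC⟩ := hf.exists_abs_le_torus
  exact MemLp.of_bound hf.aestronglyMeasurable C (Eventually.of_forall hC)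

theorem integral_mul_eq_inner {α : Type*} [MeasurableSpace α] {μ : Measure α} {f g : α → ℝ}
    (hf : MemLp f 2 μ) (hg : MemLp g 2 μ) :
    ∫ x, f x * g x ∂μ = inner ℝ (hf.toLp f) (hg.toLp g) := by
  rw [L2.inner_def]
  refine integral_congr_ae ?_
  filter_upwards [hf.coeFn_toLp, hg.coeFn_toLp] with x h1 h2
  rw [h1, h2]
  simp [mul_comm]

theorem integral_abs_mul_le_sqrt {α : Type*} [MeasurableSpace α] {μ : Measure α} {f g : α → ℝ}
    (hf : MemLp f 2 μ) (hg : MemLp g 2 μ) :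
    ∫ x, |f x * g x| ∂μ ≤ √(∫ x, f x ^ 2 ∂μ) * √(∫ x, g x ^ 2 ∂μ) := by
  have h1 := integral_mul_eq_inner hf.abs hg.abs
  have h2 := real_inner_le_norm (hf.abs.toLp) (hg.abs.toLp)
  have e1 := integral_sq_eq_norm_sq hf.abs
  have e2 := integral_sq_eq_norm_sq hg.abs
  simp only [Pi.abs_apply, sq_abs] at h1 e1 e2
  rw [e1, e2, Real.sqrt_sq (norm_nonneg _), Real.sqrt_sq (norm_nonneg _)]
  simp only [abs_mul]
  exact h1.trans_le h2

theorem integral_abs_le_sqrt {f : Torus → ℝ} (hf : MemLp f 2 volume) :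
    ∫ x, |f x| ≤ √(∫ x, f x ^ 2) := by
  have := integral_abs_mul_le_sqrt hf (memLp_const (μ := (volume : Measure Torus)) (1 : ℝ))
  simpa using this

theorem memLp_torusConv {k f : Torus → ℝ} (hk : Continuous k) (hf : Integrable f volume)
    (p : ENNReal) : MemLp (torusConv k f) p volume :=
  memLp_of_continuous_torus (continuous_torusConv hk hf) p

theorem tendsto_sqrt_torusConv {f : Torus → ℝ} (hf : MemLp f 2 volume) :
    Tendsto (fun n => √(∫ x, (torusConv (torusKernel n) f x - f x) ^ 2)) atTop (𝓝 0) := by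
  simpa using (tendsto_torusConv hf).sqrt

theorem tendsto_integral_abs_torusConv {f : Torus → ℝ} (hf : MemLp f 2 volume) :
    Tendsto (fun n => ∫ x, |torusConv (torusKernel n) f x - f x|) atTop (𝓝 0) := by
  refine tendsto_of_tendsto_of_tendsto_of_le_of_le tendsto_const_nhds (tendsto_sqrt_torusConv hf)
    (fun n => integral_nonneg fun x => abs_nonneg _) fun n => ?_
  exact integral_abs_le_sqrt ((memLp_torusConv (continuous_torusKernel n)
    (hf.integrable (by norm_num)) 2).sub hf)

/-- Split `gₙ hₙ - g h = (gₙ - g) hₙ + g (hₙ - h)` and apply Cauchy–Schwarz; mollification does not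
increase the norm of `h`, so the first term needs no further bound. -/
theorem tendsto_integral_abs_torusConv_mul {g h : Torus → ℝ} (hg : MemLp g 2 volume)
    (hh : MemLp h 2 volume) :
    Tendsto (fun n => ∫ x, |torusConv (torusKernel n) g x * torusConv (torusKernel n) h x
      - g x * h x|) atTop (𝓝 0) := by
  have hgn : ∀ n, MemLp (torusConv (torusKernel n) g) 2 volume := fun n =>
    memLp_torusConv (continuous_torusKernel n) (hg.integrable (by norm_num)) 2
  have hhn : ∀ n, MemLp (torusConv (torusKernel n) h) 2 volume := fun n =>
    memLp_torusConv (continuous_torusKernel n) (hh.integrable (by norm_num)) 2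
  have hlim : Tendsto (fun n => √(∫ x, (torusConv (torusKernel n) g x - g x) ^ 2) * √(∫ x, h x ^ 2)
      + √(∫ x, g x ^ 2) * √(∫ x, (torusConv (torusKernel n) h x - h x) ^ 2)) atTop (𝓝 0) := by
    simpa using ((tendsto_sqrt_torusConv hg).mul_const _).add
      ((tendsto_sqrt_torusConv hh).const_mul _)
  refine tendsto_of_tendsto_of_tendsto_of_le_of_le tendsto_const_nhds hlim
    (fun n => integral_nonneg fun x => abs_nonneg _) fun n => ?_
  have h1 := integral_abs_mul_le_sqrt ((hgn n).sub hg) (hhn n)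
  have h2 := integral_abs_mul_le_sqrt hg ((hhn n).sub hh)
  have h3 : √(∫ x, torusConv (torusKernel n) h x ^ 2) ≤ √(∫ x, h x ^ 2) :=
    Real.sqrt_le_sqrt (integral_sq_torusConv_le (continuous_torusKernel n) (torusKernel_nonneg n)
      (integral_torusKernel n) hh)
  have i1 := (((hgn n).sub hg).integrable_mul (hhn n)).abs
  have i2 := (hg.integrable_mul ((hhn n).sub hh)).abs
  have i3 := (((hgn n).integrable_mul (hhn n)).sub (hg.integrable_mul hh)).abs
  have h4 := integral_mono (μ := (volume : Measure Torus)) i3 (i1.add i2) fun x => by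
    simp only [Pi.sub_apply, Pi.mul_apply, Pi.add_apply]
    refine le_trans (le_of_eq ?_) (abs_add_le _ _)
    congr 1
    ring
  rw [integral_add' i1 i2] at h4
  refine h4.trans (add_le_add (h1.trans ?_) h2)
  exact mul_le_mul_of_nonneg_left h3 (Real.sqrt_nonneg _)

/-! ### Limits of nonlinear expressions in mollifications -/

theorem exists_subseq_ae_tendsto {f : Torus → ℝ} {fn : ℕ → Torus → ℝ}
    (hfn : ∀ n, Integrable (fn n) volume) (hf : Integrable f volume)
    (h : Tendsto (fun n => ∫ x, |fn n x - f x|) atTop (𝓝 0)) :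
    ∃ ms : ℕ → ℕ, StrictMono ms ∧ ∀ᵐ x, Tendsto (fun n => fn (ms n) x) atTop (𝓝 (f x)) := by
  refine TendstoInMeasure.exists_seq_tendsto_ae (μ := (volume : Measure Torus)) (f := fn) (g := f) ?_
  refine tendstoInMeasure_of_tendsto_eLpNorm (p := 1) one_ne_zero
    (fun n => (hfn n).aestronglyMeasurable) hf.aestronglyMeasurable ?_
  have h1 : ∀ n, eLpNorm (fn n - f) 1 volume = ENNReal.ofReal (∫ x, |fn n x - f x|) := fun n => by
    rw [eLpNorm_one_eq_lintegral_enorm, ← ofReal_integral_norm_eq_lintegral_enorm ((hfn n).sub hf)]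
    rfl
  simp only [h1]
  simpa using ENNReal.tendsto_ofReal h

/-- `L¹` convergence gives pointwise convergence only along subsequences, which is enough since the
limit is always the same. Along one of them, `Φ(fₙ) aₙ = Φ(fₙ) (aₙ - a) + Φ(fₙ) a`: the first term
is small in `L¹` and the second is dominated by `M |a|`. -/
theorem tendsto_integral_comp_mul {f a : Torus → ℝ} {fn an : ℕ → Torus → ℝ} {S : Set ℝ}
    {Φ : ℝ → ℝ} {M : ℝ}
    (hfn : ∀ n, Continuous (fn n)) (hf : Integrable f volume)
    (h : Tendsto (fun n => ∫ x, |fn n x - f x|) atTop (𝓝 0))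
    (han : ∀ n, Integrable (an n) volume) (ha : Integrable a volume)
    (h' : Tendsto (fun n => ∫ x, |an n x - a x|) atTop (𝓝 0))
    (hS : ∀ n x, fn n x ∈ S) (hfS : ∀ᵐ x, f x ∈ S) (hΦ : ContinuousOn Φ S)
    (hM : ∀ r ∈ S, |Φ r| ≤ M) :
    Tendsto (fun n => ∫ x, Φ (fn n x) * an n x) atTop (𝓝 (∫ x, Φ (f x) * a x)) := by
  refine tendsto_of_subseq_tendsto fun ns hns => ?_
  obtain ⟨ms, hms, hae⟩ := exists_subseq_ae_tendsto (fn := fun n => fn (ns n))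
    (fun n => torus_integrable_of_continuous (hfn _)) hf (h.comp hns)
  refine ⟨ms, ?_⟩
  have hc : ∀ n, Continuous fun x => Φ (fn n x) := fun n => hΦ.comp_continuous (hfn n) (hS n)
  have hae' : ∀ᵐ x, Tendsto (fun n => Φ (fn (ns (ms n)) x)) atTop (𝓝 (Φ (f x))) := by
    filter_upwards [hae, hfS] with x hx hxS
    exact (hΦ (f x) hxS).tendsto.comp
      (tendsto_nhdsWithin_iff.2 ⟨hx, Eventually.of_forall fun n => hS _ x⟩)
  have hm : AEStronglyMeasurable (fun x => Φ (f x)) volume :=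
    aestronglyMeasurable_of_tendsto_ae atTop (fun n => (hc _).aestronglyMeasurable) hae'
  have hfM : ∀ᵐ x, ‖Φ (f x)‖ ≤ M := by
    filter_upwards [hfS] with x hx using hM _ hx
  have hsub : Tendsto (fun n => ns (ms n)) atTop atTop := hns.comp hms.tendsto_atTop
  have t1 : Tendsto (fun n => ∫ x, Φ (fn (ns (ms n)) x) * a x) atTop (𝓝 (∫ x, Φ (f x) * a x)) := by
    refine tendsto_integral_of_dominated_convergence (fun x => M * |a x|)
      (fun n => (hc _).aestronglyMeasurable.mul ha.aestronglyMeasurable) (ha.abs.const_mul M)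
      (fun n => Eventually.of_forall fun x => ?_) ?_
    · rw [norm_mul]
      exact mul_le_mul_of_nonneg_right (hM _ (hS _ x)) (norm_nonneg _)
    · filter_upwards [hae'] with x hx using hx.mul_const _
  have t2 : Tendsto (fun n => ∫ x, Φ (fn (ns (ms n)) x) * (an (ns (ms n)) x - a x)) atTop (𝓝 0) := by
    have h3 := ((h'.comp hsub).const_mul M)
    rw [mul_zero] at h3
    refine squeeze_zero_norm (fun n => ?_) h3
    rw [Function.comp_apply, ← integral_const_mul]
    refine norm_integral_le_of_norm_le (((han _).sub ha).abs.const_mul M)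
      (Eventually.of_forall fun x => ?_)
    rw [norm_mul]
    exact mul_le_mul_of_nonneg_right (hM _ (hS _ x)) (norm_nonneg _)
  have t3 := t2.add t1
  rw [zero_add] at t3
  refine t3.congr fun n => ?_
  rw [← integral_add]
  · refine integral_congr_ae (Eventually.of_forall fun x => ?_)
    dsimp only
    ring
  · exact ((han _).sub ha).bdd_mul (hc _).aestronglyMeasurable
      (Eventually.of_forall fun x => hM _ (hS _ x))
  · exact ha.bdd_mul (hc _).aestronglyMeasurable (Eventually.of_forall fun x => hM _ (hS _ x))

theorem abs_sub_le_of_hasDerivAt {S : Set ℝ} (hS : Convex ℝ S) {F F' : ℝ → ℝ} {L : ℝ}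
    (hF : ∀ r ∈ S, HasDerivAt F (F' r) r) (hL : ∀ r ∈ S, |F' r| ≤ L) {r s : ℝ} (hr : r ∈ S)
    (hs : s ∈ S) : |F r - F s| ≤ L * |r - s| :=
  hS.norm_image_sub_le_of_norm_hasDerivWithin_le (fun x hx => (hF x hx).hasDerivWithinAt) hL hs hr

/-- Entropies may be unbounded, so no uniform bound on `Φ` is available; the Lipschitz estimate
turns `L¹` convergence of the mollifications directly into convergence of the integrals. -/
theorem tendsto_integral_comp_torusConv {f : Torus → ℝ} (hf : MemLp f 2 volume) {S : Set ℝ}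
    {Φ : ℝ → ℝ} {L : ℝ} (hS : ∀ n x, torusConv (torusKernel n) f x ∈ S) (hfS : ∀ᵐ x, f x ∈ S)
    (hm : AEStronglyMeasurable (fun x => Φ (f x)) volume)
    (hΦ : ∀ r ∈ S, ∀ s ∈ S, |Φ r - Φ s| ≤ L * |r - s|) :
    Integrable (fun x => Φ (f x)) volume ∧
    (∀ n, Integrable (fun x => Φ (torusConv (torusKernel n) f x)) volume) ∧
    Tendsto (fun n => ∫ x, Φ (torusConv (torusKernel n) f x)) atTop (𝓝 (∫ x, Φ (f x))) := by
  have hfi : Integrable f volume := hf.integrable (by norm_num)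
  have hc := fun n => continuous_torusConv (continuous_torusKernel n) hfi
  have hcn := fun n => torus_integrable_of_continuous (hc n)
  have hΦc : ContinuousOn Φ S := by
    have : LipschitzOnWith (Real.toNNReal L) Φ S := LipschitzOnWith.of_dist_le_mul fun r hr s hs => by
      rw [Real.dist_eq, Real.dist_eq]
      exact (hΦ r hr s hs).trans
        (mul_le_mul_of_nonneg_right (Real.le_coe_toNNReal L) (abs_nonneg _))
    exact this.continuousOn
  have i2 : ∀ n, Integrable (fun x => Φ (torusConv (torusKernel n) f x)) volume :=
    fun n => torus_integrable_of_continuous (hΦc.comp_continuous (hc n) (hS n))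
  have hle : ∀ n, ∀ᵐ x, ‖Φ (torusConv (torusKernel n) f x) - Φ (f x)‖
      ≤ L * |torusConv (torusKernel n) f x - f x| := fun n => by
    filter_upwards [hfS] with x hx using hΦ _ (hS n x) _ hx
  have i3 : ∀ n, Integrable (fun x => Φ (torusConv (torusKernel n) f x) - Φ (f x)) volume := fun n =>
    Integrable.mono' (((hcn n).sub hfi).abs.const_mul L) ((i2 n).aestronglyMeasurable.sub hm) (hle n)
  have i1 : Integrable (fun x => Φ (f x)) volume :=
    ((i2 0).sub (i3 0)).congr (Eventually.of_forall fun x => by simp)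
  refine ⟨i1, i2, ?_⟩
  rw [tendsto_iff_norm_sub_tendsto_zero]
  have h3 := (tendsto_integral_abs_torusConv hf).const_mul L
  rw [mul_zero] at h3
  refine squeeze_zero (fun n => norm_nonneg _) (fun n => ?_) h3
  rw [← integral_sub (i2 n) i1, ← integral_const_mul]
  exact norm_integral_le_of_norm_le (((hcn n).sub hfi).abs.const_mul L) (hle n)

/-- One-dimensional Sobolev inequality `‖W(f)‖_∞ ≤ ‖W(f)‖₁ + ‖W'(f) f'‖₁` on the torus. -/
theorem HasWeakDeriv.ae_abs_comp_le {f g : Torus → ℝ} (h : HasWeakDeriv f g)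
    (hf : MemLp f 2 volume) (hg : MemLp g 2 volume) {S : Set ℝ} (hSc : Convex ℝ S)
    (hS : ∀ n x, torusConv (torusKernel n) f x ∈ S) (hfS : ∀ᵐ x, f x ∈ S) {W W' : ℝ → ℝ} {L : ℝ}
    (hm : AEStronglyMeasurable (fun x => W (f x)) volume)
    (hW : ∀ r ∈ S, HasDerivAt W (W' r) r) (hWc : ContinuousOn W' S) (hL : ∀ r ∈ S, |W' r| ≤ L) :
    ∀ᵐ x, |W (f x)| ≤ (∫ y, |W (f y)|) + ∫ y, |W' (f y)| * |g y| := by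
  have hgi : Integrable g volume := hg.integrable (by norm_num)
  have hc := fun n => continuous_torusConv (continuous_torusKernel n) h.1
  have hcg := fun n => continuous_torusConv (continuous_torusKernel n) hgi
  have hLip := fun r hr s hs => abs_sub_le_of_hasDerivAt hSc hW hL (r := r) (s := s) hr hs
  obtain ⟨-, -, t1⟩ := tendsto_integral_comp_torusConv hf hS hfS
    (Φ := fun r => |W r|) (L := L) hm.norm
    (fun r hr s hs => (abs_abs_sub_abs_le _ _).trans (hLip r hr s hs))
  have t2 := tendsto_integral_comp_mul (Φ := fun r => |W' r|) (M := L) hc h.1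
    (tendsto_integral_abs_torusConv hf)
    (an := fun n x => |torusConv (torusKernel n) g x|) (a := fun x => |g x|)
    (fun n => (torus_integrable_of_continuous (hcg n)).abs) hgi.abs
    (squeeze_zero (fun n => integral_nonneg fun x => abs_nonneg _)
      (fun n => integral_mono (((torus_integrable_of_continuous (hcg n)).abs.sub hgi.abs).abs)
        ((torus_integrable_of_continuous (hcg n)).sub hgi).abs
        fun x => abs_abs_sub_abs_le _ _) (tendsto_integral_abs_torusConv hg))
    hS hfS hWc.abs (fun r hr => by rw [abs_abs]; exact hL r hr)
  obtain ⟨ms, hms, hae⟩ := exists_subseq_ae_tendsto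
    (fun n => torus_integrable_of_continuous (hc n)) h.1 (tendsto_integral_abs_torusConv hf)
  have t3 := (t1.add t2).comp hms.tendsto_atTop
  filter_upwards [hae, hfS] with x hx hxS
  have t4 : Tendsto (fun n => |W (torusConv (torusKernel (ms n)) f x)|) atTop (𝓝 |W (f x)|) :=
    ((hW _ hxS).continuousAt.tendsto.comp hx).abs
  refine le_of_tendsto_of_tendsto' t4 t3 fun n => ?_
  -- The classical inequality applies to the mollification, whose derivative is the mollification of
  -- `g`.
  have hd := hasTorusDeriv_torusConv (torusSmooth_torusKernel (ms n)) h.1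
  rw [h.torusConv_torusDeriv (torusSmooth_torusKernel (ms n))] at hd
  have h5 := (hd.comp (F := W) (F' := W') fun x => hW _ (hS _ x)).abs_le
    ((hWc.comp_continuous (hc _) (hS _)).mul (hcg _)) x
  simpa only [abs_mul, Function.comp_apply] using h5

/-! ### Absolutely continuous functions of time -/

theorem AbsolutelyContinuousOnInterval.of_abs_sub_le {f g : ℝ → ℝ} {a b L : ℝ}
    (hf : AbsolutelyContinuousOnInterval f a b)
    (h : ∀ x ∈ uIcc a b, ∀ y ∈ uIcc a b, |g x - g y| ≤ L * |f x - f y|) :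
    AbsolutelyContinuousOnInterval g a b := by
  rw [absolutelyContinuousOnInterval_iff] at hf ⊢
  intro ε hε
  -- `|L| + 1` keeps the divisor positive whatever the sign of `L`.
  obtain ⟨δ, hδ, H⟩ := hf (ε / (|L| + 1)) (by positivity)
  refine ⟨δ, hδ, fun E hE hlen => ?_⟩
  have h1 := H E hE hlen
  have h2 : ∑ i ∈ Finset.range E.1, dist (g (E.2 i).1) (g (E.2 i).2)
      ≤ (|L| + 1) * ∑ i ∈ Finset.range E.1, dist (f (E.2 i).1) (f (E.2 i).2) := by
    rw [Finset.mul_sum]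
    refine Finset.sum_le_sum fun i hi => ?_
    have h3 := hE.1 i hi
    rw [Real.dist_eq, Real.dist_eq]
    refine (h _ h3.1 _ h3.2).trans (mul_le_mul_of_nonneg_right ?_ (abs_nonneg _))
    linarith [le_abs_self L]
  refine h2.trans_lt ?_
  rwa [lt_div_iff₀' (by positivity)] at h1

/-- Chain rule for the composition of a `C¹` function with a primitive of an integrable function. -/
theorem comp_primitive_sub_eq_integral {b R : ℝ → ℝ} {t R₀ L : ℝ} (ht : 0 ≤ t)
    (hb : IntervalIntegrable b volume 0 t) (hR : ∀ s ∈ Icc 0 t, R s = R₀ + ∫ r in (0 : ℝ)..s, b r)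
    {S : Set ℝ} (hS : Convex ℝ S) {F F' : ℝ → ℝ} (hF : ∀ r ∈ S, HasDerivAt F (F' r) r)
    (hL : ∀ r ∈ S, |F' r| ≤ L) (hRS : ∀ s ∈ Icc 0 t, R s ∈ S) :
    F (R t) - F R₀ = ∫ s in (0 : ℝ)..t, F' (R s) * b s := by
  -- `R` is known only on `[0, t]`; the primitive `P` is defined on the whole line and has honest
  -- two-sided derivatives almost everywhere.
  set P : ℝ → ℝ := fun s => R₀ + ∫ r in (0 : ℝ)..s, b r with hP
  have hPac : AbsolutelyContinuousOnInterval P 0 t := by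
    have h1 := hb.absolutelyContinuousOnInterval_intervalIntegral (c := 0) (by simp)
    refine h1.of_abs_sub_le (L := 1) fun x _ y _ => ?_
    simp [hP]
  have hPS : ∀ s ∈ Icc 0 t, P s ∈ S := fun s hs => by
    rw [hP]
    dsimp only
    rw [← hR s hs]
    exact hRS s hs
  have hac : AbsolutelyContinuousOnInterval (fun s => F (P s)) 0 t := by
    refine hPac.of_abs_sub_le (L := L) fun x hx y hy => ?_
    rw [uIcc_of_le ht] at hx hy
    exact abs_sub_le_of_hasDerivAt hS hF hL (hPS x hx) (hPS y hy)
  have h2 := hac.integral_deriv_eq_sub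
  have e0 : P 0 = R₀ := by simp [hP]
  rw [e0] at h2
  rw [hR t ⟨ht, le_rfl⟩]
  change F (P t) - F R₀ = _
  rw [← h2]
  refine intervalIntegral.integral_congr_ae ?_
  filter_upwards [hb.ae_hasDerivAt_integral] with s hs hst
  have hs' : s ∈ uIcc 0 t := uIoc_subset_uIcc hst
  have h3 : HasDerivAt P (b s) s := (hs hs' 0 (by simp)).const_add R₀
  rw [uIcc_of_le ht] at hs'
  rw [hR s hs']
  exact ((hF _ (hPS s hs')).comp s h3).deriv

/-! ### Time slices of the cylinder and continuity in time with values in `L²` -/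

theorem swap_ae_cylinder {T : ℝ} {p : Torus × ℝ → Prop} (h : ∀ᵐ z ∂(cylinderMeasure T), p z) :
    ∀ᵐ t ∂(volume.restrict (Ioo 0 T)), ∀ᵐ x : Torus, p (x, t) := by
  have h1 : ∀ᵐ z ∂((volume.restrict (Ioo 0 T)).prod (volume : Measure Torus)), p z.swap :=
    Measure.measurePreserving_swap.quasiMeasurePreserving.ae h
  exact Measure.ae_ae_of_ae_prod h1

theorem ae_memLp_slice {T : ℝ} {f : Torus × ℝ → ℝ} (hf : MemLp f 2 (cylinderMeasure T)) :
    ∀ᵐ t ∂(volume.restrict (Ioo 0 T)), MemLp (fun x => f (x, t)) 2 volume := by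
  have h1 := hf.1.prod_swap.prodMk_left
  have h2 := hf.integrable_sq.prod_left_ae
  filter_upwards [h1, h2] with t ht1 ht2
  exact (memLp_two_iff_integrable_sq ht1).2 ht2

theorem cylinder_integral_eq {T : ℝ} {f : Torus × ℝ → ℝ} (hf : Integrable f (cylinderMeasure T)) :
    ∫ z, f z ∂(cylinderMeasure T) = ∫ t in Ioo 0 T, ∫ x, f (x, t) :=
  integral_prod_symm f hf

theorem integrable_integral_slice {T : ℝ} {f : Torus × ℝ → ℝ}
    (hf : Integrable f (cylinderMeasure T)) :
    IntegrableOn (fun t => ∫ x, f (x, t)) (Ioo 0 T) volume :=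
  hf.integral_prod_right

instance isFiniteMeasure_cylinderMeasure (T : ℝ) : IsFiniteMeasure (cylinderMeasure T) := by
  unfold cylinderMeasure
  infer_instance

theorem measurable_oneDet (τ : ℝ) : Measurable (oneDet τ) :=
  measurable_one.indicator (MeasurableSet.iUnion fun _ => measurableSet_Ico)

theorem oneDet_eq_zero_or_one (τ t : ℝ) : oneDet τ t = 0 ∨ oneDet τ t = 1 := by
  unfold oneDet
  by_cases h : t ∈ ⋃ k : ℕ, Ico ((2 * (k : ℝ)) * τ) ((2 * (k : ℝ) + 1) * τ)
  · right
    simp [indicator_of_mem h]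
  · left
    simp [indicator_of_notMem h]

theorem oneDet_mul_self (τ t : ℝ) : oneDet τ t * oneDet τ t = oneDet τ t := by
  rcases oneDet_eq_zero_or_one τ t with h | h <;> simp [h]

theorem abs_oneDet_le (τ t : ℝ) : |oneDet τ t| ≤ 1 := by
  rcases oneDet_eq_zero_or_one τ t with h | h <;> simp [h]

theorem ae_cylinder_time_mem (T : ℝ) : ∀ᵐ z ∂(cylinderMeasure T), z.2 ∈ Ioo 0 T :=
  Measure.quasiMeasurePreserving_snd.ae (ae_restrict_mem measurableSet_Ioo)

theorem memLp_cylinder_of_continuous {T : ℝ} {h : Torus × ℝ → ℝ} (hc : Continuous h)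
    (p : ENNReal) : MemLp h p (cylinderMeasure T) := by
  obtain ⟨C, hC⟩ := ((isCompact_univ (X := Torus)).prod
    (isCompact_Icc (a := (0 : ℝ)) (b := T))).exists_bound_of_continuousOn hc.continuousOn
  refine MemLp.of_bound hc.aestronglyMeasurable C ?_
  filter_upwards [ae_cylinder_time_mem T] with z hz
  exact hC z ⟨mem_univ _, Ioo_subset_Icc_self hz⟩

namespace MemCL2

variable {T : ℝ} {ρ : Torus × ℝ → ℝ}

theorem continuous_toLp (h : MemCL2 T ρ) :
    Continuous (fun t : Icc 0 T => (h.2.1 t t.2).toLp (fun x => ρ (x, t))) := by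
  refine continuous_iff_continuousAt.2 fun t => ?_
  refine (Lp.tendsto_Lp_iff_tendsto_eLpNorm'' (fun (s : Icc 0 T) x => ρ (x, s))
    (fun s => h.2.1 s s.2) _ (h.2.1 t t.2)).2 ?_
  have h1 := h.2.2 t t.2
  rw [nhdsWithin_eq_map_subtype_coe t.2] at h1
  exact h1

theorem exists_integral_sq_le (h : MemCL2 T ρ) : ∃ M, 0 ≤ M ∧ ∀ t ∈ Icc 0 T,
    ∫ x, ρ (x, t) ^ 2 ≤ M := by
  obtain ⟨C, hC⟩ := isCompact_univ.exists_bound_of_continuousOn h.continuous_toLp.continuousOn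
  refine ⟨C ^ 2, sq_nonneg _, fun t ht => ?_⟩
  rw [integral_sq_eq_norm_sq (h.2.1 t ht)]
  exact pow_le_pow_left₀ (norm_nonneg _) (hC ⟨t, ht⟩ (mem_univ _)) 2

theorem continuousOn_integral_mul (h : MemCL2 T ρ) {ψ : Torus → ℝ} (hψ : Continuous ψ) :
    ContinuousOn (fun t => ∫ x, ρ (x, t) * ψ x) (Icc 0 T) := by
  rw [continuousOn_iff_continuous_domRestrict]
  refine (h.continuous_toLp.inner (𝕜 := ℝ) (continuous_const
    (y := (memLp_of_continuous_torus hψ 2).toLp ψ))).congr fun t => ?_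
  exact (integral_mul_eq_inner (h.2.1 t t.2) (memLp_of_continuous_torus hψ 2)).symm

theorem memLp (h : MemCL2 T ρ) : MemLp ρ 2 (cylinderMeasure T) := by
  obtain ⟨M, -, hM⟩ := h.exists_integral_sq_le
  refine (memLp_two_iff_integrable_sq h.1).2 ((integrable_prod_iff' (h.1.pow 2)).2 ⟨?_, ?_⟩)
  · filter_upwards [ae_restrict_mem measurableSet_Ioo] with t ht
    exact (h.2.1 t (Ioo_subset_Icc_self ht)).integrable_sq
  · refine Integrable.mono' (integrable_const M) (h.1.pow 2).prod_swap.norm.integral_prod_right' ?_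
    filter_upwards [ae_restrict_mem measurableSet_Ioo] with t ht
    rw [Real.norm_eq_abs, abs_of_nonneg (integral_nonneg fun x => norm_nonneg _)]
    simpa using hM t (Ioo_subset_Icc_self ht)

end MemCL2

/-! ### From the space-time weak formulation to fixed times -/

theorem HasTorusDeriv.hasWeakDeriv {φ φ' : Torus → ℝ} (h : HasTorusDeriv φ φ')
    (hc : Continuous φ') : HasWeakDeriv φ φ' :=
  ⟨torus_integrable_of_continuous h.continuous, torus_integrable_of_continuous hc, fun _ hψ =>
    h.integral_mul_eq hψ.hasTorusDeriv hc hψ.continuous_torusDeriv⟩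

theorem HasTorusDeriv.mul_const {φ φ' : Torus → ℝ} (h : HasTorusDeriv φ φ') (c : ℝ) :
    HasTorusDeriv (fun x => φ x * c) (fun x => φ' x * c) := fun x => (h x).mul_const c

/-- Writing the time factor as an integral up to `T` makes it vanish at `T`, while its derivative
`-ζ` can be prescribed freely. -/
theorem isTestFunction_mul {T τ : ℝ} {ψ : Torus → ℝ} (hψ : TorusSmooth ψ) {ζ : ℝ → ℝ}
    (hζ : Continuous ζ) :
    IsTestFunction T τ (fun z => ψ z.1 * ∫ s in z.2..T, ζ s) (fun z => - (ψ z.1 * ζ z.2))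
      (fun z => oneDet τ z.2 * (torusDeriv ψ z.1 * ∫ s in z.2..T, ζ s)) := by
  have hψc := hψ.continuous
  have hψ'c := hψ.continuous_torusDeriv
  have hθ : Continuous fun t : ℝ => ∫ s in t..T, ζ s := by
    have h1 : Continuous fun t : ℝ => ∫ s in T..t, ζ s :=
      intervalIntegral.continuous_primitive (fun a b => hζ.intervalIntegrable a b) T
    refine h1.neg.congr fun t => ?_
    exact (intervalIntegral.integral_symm T t).symm
  have hd : ∀ {h : Torus × ℝ → ℝ}, Continuous h →
      MemLp (fun z => oneDet τ z.2 * h z) 2 (cylinderMeasure T) := fun {h} hh => by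
    have h1 := memLp_cylinder_of_continuous (T := T) hh 2
    refine h1.of_le (((measurable_oneDet τ).comp measurable_snd).aestronglyMeasurable.mul h1.1)
      (Eventually.of_forall fun z => ?_)
    rw [norm_mul]
    exact mul_le_of_le_one_left (norm_nonneg _) (abs_oneDet_le τ z.2)
  refine ⟨⟨memLp_cylinder_of_continuous (by fun_prop) 2,
    memLp_cylinder_of_continuous (by fun_prop) 2, Eventually.of_forall fun x t _ => ?_⟩,
    Eventually.of_forall fun x => by simp, hd (by fun_prop), hd (by fun_prop),
    Eventually.of_forall fun t => ?_⟩
  · simp only [intervalIntegral.integral_neg, intervalIntegral.integral_const_mul]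
    rw [← intervalIntegral.integral_add_adjacent_intervals (hζ.intervalIntegrable 0 t)
      (hζ.intervalIntegrable t T)]
    ring
  · have h1 := hψ.hasTorusDeriv.mul_const (oneDet τ t * ∫ s in t..T, ζ s)
    have h2 := h1.hasWeakDeriv (by fun_prop)
    convert! h2 using 2
    · ring
    · ring

/-- The weak formulation at a fixed time, tested with a function of the space variable. -/
theorem integral_mul_eq_of_weak_formulation {T τ : ℝ} (hT : 0 < T) {u ρ ρx : Torus × ℝ → ℝ}
    {ρ₀ : Torus → ℝ} (hC : MemCL2 T ρ)
    (hG : MemLp (fun z => oneDet τ z.2 * (ρ z * u z - ρx z)) 2 (cylinderMeasure T))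
    (hw : ∀ φ φt φx : Torus × ℝ → ℝ, IsTestFunction T τ φ φt φx →
        (∫ z, ((1 / 2 : ℝ) * (ρ z * φt z) + oneDet τ z.2 * ((ρ z * u z - ρx z) * φx z))
            ∂(cylinderMeasure T))
          + (1 / 2 : ℝ) * ∫ x : Torus, ρ₀ x * φ (x, 0) = 0)
    {ψ : Torus → ℝ} (hψ : TorusSmooth ψ) :
    ∀ t ∈ Icc 0 T, ∫ x, ρ (x, t) * ψ x = (∫ x, ρ₀ x * ψ x)
      + 2 * ∫ s in (0 : ℝ)..t, ∫ x, oneDet τ s * (ρ (x, s) * u (x, s) - ρx (x, s)) * torusDeriv ψ x := by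
  have hψc := hψ.continuous
  have hψ'c := hψ.continuous_torusDeriv
  set G : Torus × ℝ → ℝ := fun z => oneDet τ z.2 * (ρ z * u z - ρx z) with hGdef
  set a : ℝ → ℝ := fun t => ∫ x, ρ (x, t) * ψ x with ha
  set b : ℝ → ℝ := fun s => ∫ x, G (x, s) * torusDeriv ψ x with hb
  set a₀ : ℝ := ∫ x, ρ₀ x * ψ x
  have iG : Integrable (fun z => G z * torusDeriv ψ z.1) (cylinderMeasure T) :=
    hG.integrable_mul (memLp_cylinder_of_continuous (by fun_prop : Continuous
      fun z : Torus × ℝ => torusDeriv ψ z.1) 2)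
  have ibo : IntegrableOn b (Ioo 0 T) volume := integrable_integral_slice iG
  have ib : IntervalIntegrable b volume 0 T :=
    (intervalIntegrable_iff_integrableOn_Ioo_of_le hT.le).2 ibo
  have hac : ContinuousOn a (Icc 0 T) := hC.continuousOn_integral_mul hψc
  have hBac := ib.absolutelyContinuousOnInterval_intervalIntegral (c := 0) (by simp)
  set B : ℝ → ℝ := fun t => ∫ s in (0 : ℝ)..t, b s with hB
  have hBc : ContinuousOn B (Icc 0 T) := by
    have := hBac.continuousOn
    rwa [uIcc_of_le hT.le] at this
  set H : ℝ → ℝ := fun t => a t / 2 - a₀ / 2 - B t with hH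
  have hHc : ContinuousOn H (Icc 0 T) := ((hac.div_const 2).sub continuousOn_const).sub hBc
  -- `H` is the defect in the claimed identity. Prescribing it, extended continuously to the line,
  -- as `ζ` turns the weak formulation into `∫ H² = 0`.
  set ζ : ℝ → ℝ := IccExtend hT.le ((Icc 0 T).domRestrict H) with hζ
  have hζc : Continuous ζ := (continuousOn_iff_continuous_domRestrict.1 hHc).Icc_extend'
  have hζH : ∀ t ∈ Icc 0 T, ζ t = H t := fun t ht => by
    rw [hζ, IccExtend_of_mem _ _ ht]
    rfl
  have h1 := hw _ _ _ (isTestFunction_mul (T := T) (τ := τ) hψ hζc)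
  set θ : ℝ → ℝ := fun t => ∫ s in t..T, ζ s with hθ
  have hθd : ∀ t, HasDerivAt θ (- ζ t) t := fun t =>
    intervalIntegral.integral_hasDerivAt_left (hζc.intervalIntegrable _ _)
      (hζc.stronglyMeasurableAtFilter _ _) hζc.continuousAt
  have hθc : Continuous θ := continuous_iff_continuousAt.2 fun t => (hθd t).continuousAt
  have e1 : ∀ z : Torus × ℝ, (1 / 2 : ℝ) * (ρ z * - (ψ z.1 * ζ z.2))
      + oneDet τ z.2 * ((ρ z * u z - ρx z) * (oneDet τ z.2 * (torusDeriv ψ z.1 * θ z.2)))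
      = (-1 / 2 : ℝ) * (ρ z * (ψ z.1 * ζ z.2)) + G z * (torusDeriv ψ z.1 * θ z.2) := fun z => by
    rw [hGdef]
    dsimp only
    linear_combination ((ρ z * u z - ρx z) * (torusDeriv ψ z.1 * θ z.2)) * oneDet_mul_self τ z.2
  have j1 : Integrable (fun z => ρ z * (ψ z.1 * ζ z.2)) (cylinderMeasure T) :=
    hC.memLp.integrable_mul (memLp_cylinder_of_continuous (by fun_prop : Continuous
      fun z : Torus × ℝ => ψ z.1 * ζ z.2) 2)
  have j2 : Integrable (fun z => G z * (torusDeriv ψ z.1 * θ z.2)) (cylinderMeasure T) :=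
    hG.integrable_mul (memLp_cylinder_of_continuous (by fun_prop : Continuous
      fun z : Torus × ℝ => torusDeriv ψ z.1 * θ z.2) 2)
  have e2 : (∫ z, ((1 / 2 : ℝ) * (ρ z * - (ψ z.1 * ζ z.2))
      + oneDet τ z.2 * ((ρ z * u z - ρx z) * (oneDet τ z.2 * (torusDeriv ψ z.1 * θ z.2))))
      ∂(cylinderMeasure T)) = (-1 / 2) * (∫ t in (0 : ℝ)..T, a t * ζ t)
        + ∫ t in (0 : ℝ)..T, b t * θ t := by
    simp only [e1]
    rw [integral_add (j1.const_mul _) j2, integral_const_mul, cylinder_integral_eq j1,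
      cylinder_integral_eq j2, intervalIntegral.integral_of_le hT.le,
      intervalIntegral.integral_of_le hT.le, integral_Ioc_eq_integral_Ioo,
      integral_Ioc_eq_integral_Ioo]
    simp only [ha, hb, ← integral_mul_const, mul_assoc]
  -- Integration by parts in time; the boundary terms vanish because `θ T = 0` and `B 0 = 0`.
  have e3 : (∫ t in (0 : ℝ)..T, b t * θ t) = ∫ t in (0 : ℝ)..T, B t * ζ t := by
    have hθac : AbsolutelyContinuousOnInterval θ 0 T := by
      have h2 := (hζc.intervalIntegrable 0 T).absolutelyContinuousOnInterval_intervalIntegral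
        (c := T) (by simp)
      refine h2.of_abs_sub_le (L := 1) fun x _ y _ => ?_
      rw [hθ]
      dsimp only
      rw [intervalIntegral.integral_symm T x, intervalIntegral.integral_symm T y, one_mul,
        ← abs_neg]
      refine le_of_eq (congrArg _ ?_)
      ring
    have h3 := hθac.integral_mul_deriv_eq_deriv_mul hBac
    have h4 : θ T = 0 := by simp [hθ]
    have h5 : B 0 = 0 := by simp [hB]
    change ∫ x in (0 : ℝ)..T, θ x * deriv B x = θ T * B T - θ 0 * B 0 - _ at h3
    rw [h4, h5] at h3
    have h6 : ∫ t in (0 : ℝ)..T, θ t * deriv B t = ∫ t in (0 : ℝ)..T, b t * θ t := by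
      refine intervalIntegral.integral_congr_ae ?_
      filter_upwards [ib.ae_hasDerivAt_integral] with s hs hst
      rw [(hs (uIoc_subset_uIcc hst) 0 (by simp)).deriv, mul_comm]
    rw [← h6, h3, zero_mul, mul_zero, sub_zero, zero_sub, ← intervalIntegral.integral_neg]
    refine intervalIntegral.integral_congr fun t _ => ?_
    rw [(hθd t).deriv]
    ring
  have e4 : ∫ x, ρ₀ x * (ψ x * θ 0) = ∫ t in (0 : ℝ)..T, a₀ * ζ t := by
    simp only [← mul_assoc]
    rw [integral_mul_const, intervalIntegral.integral_const_mul]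
  have hmul : ∀ {f : ℝ → ℝ}, ContinuousOn f (Icc 0 T) →
      IntervalIntegrable (fun t => f t * ζ t) volume 0 T := fun {f} hf => by
    refine ContinuousOn.intervalIntegrable ?_
    rw [uIcc_of_le hT.le]
    exact hf.mul hζc.continuousOn
  have h2 : ∫ t in (0 : ℝ)..T, ζ t * ζ t = 0 := by
    have h3 : (-1 / 2) * (∫ t in (0 : ℝ)..T, a t * ζ t) + (∫ t in (0 : ℝ)..T, B t * ζ t)
        + 1 / 2 * (∫ t in (0 : ℝ)..T, a₀ * ζ t) = 0 := by
      rw [← e3, ← e2, ← e4]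
      exact h1
    rw [← intervalIntegral.integral_const_mul, ← intervalIntegral.integral_const_mul,
      ← intervalIntegral.integral_add ((hmul hac).const_mul _) (hmul hBc),
      ← intervalIntegral.integral_add (((hmul hac).const_mul _).add (hmul hBc))
        ((hmul continuousOn_const).const_mul _)] at h3
    refine neg_eq_zero.1 (Eq.trans ?_ h3)
    rw [← intervalIntegral.integral_neg]
    refine intervalIntegral.integral_congr fun t ht => ?_
    rw [uIcc_of_le hT.le] at ht
    have h4 := hζH t ht
    nth_rewrite 1 [h4]
    rw [hH]
    ring
  have h3 : ∀ t ∈ Icc 0 T, ζ t * ζ t = 0 := by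
    rw [intervalIntegral.integral_of_le hT.le,
      setIntegral_eq_zero_iff_of_nonneg_ae (Eventually.of_forall fun t => mul_self_nonneg _)
        ((hζc.mul hζc).integrableOn_Ioc)] at h2
    have h4 : (fun t => ζ t * ζ t) =ᵐ[volume.restrict (Icc 0 T)] 0 := by
      rw [restrict_Ioc_eq_restrict_Icc] at h2
      exact h2
    have := Measure.eqOn_Icc_of_ae_eq volume hT.ne h4 (hζc.mul hζc).continuousOn
      continuousOn_const
    exact this
  intro t ht
  have h4 := mul_self_eq_zero.1 (h3 t ht)
  rw [hζH t ht] at h4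
  have h5 : a t = a₀ + 2 * B t := by
    rw [hH] at h4
    dsimp only at h4
    linarith
  exact h5

/-! ### The entropy identity by mollification in space -/

theorem cylinderMeasure_mono {t T : ℝ} (h : t ≤ T) : cylinderMeasure t ≤ cylinderMeasure T := by
  have e : ∀ r : ℝ, cylinderMeasure r
      = ((volume : Measure Torus).prod (volume : Measure ℝ)).restrict (univ ×ˢ Ioo 0 r) := fun r => by
    rw [← Measure.prod_restrict, Measure.restrict_univ]
    rfl
  rw [e, e]
  exact Measure.restrict_mono (prod_mono le_rfl (Ioo_subset_Ioo_right h)) le_rfl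

theorem aestronglyMeasurable_torusConv {T : ℝ} {k : Torus → ℝ} (hk : Continuous k)
    {G : Torus × ℝ → ℝ} (hG : AEStronglyMeasurable G (cylinderMeasure T)) :
    AEStronglyMeasurable (fun z : Torus × ℝ => torusConv k (fun y => G (y, z.2)) z.1)
      (cylinderMeasure T) := by
  have h1 : MeasurePreserving (fun q : (Torus × ℝ) × Torus => (q.2, q.1.2))
      ((cylinderMeasure T).prod (volume : Measure Torus)) (cylinderMeasure T) :=
    Measure.measurePreserving_swap.comp
      ((measurePreserving_snd (μ := (volume : Measure Torus)) (ν := volume.restrict (Ioo 0 T))).prod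
        (MeasurePreserving.id (volume : Measure Torus)))
  have h2 : AEStronglyMeasurable (fun q : (Torus × ℝ) × Torus => k (q.1.1 - q.2) * G (q.2, q.1.2))
      ((cylinderMeasure T).prod (volume : Measure Torus)) :=
    (by fun_prop : Continuous fun q : (Torus × ℝ) × Torus => k (q.1.1 - q.2)).aestronglyMeasurable.mul
      (hG.comp_measurePreserving h1)
  exact h2.integral_prod_right'

theorem integrable_torusConv_cylinder {T : ℝ} {k : Torus → ℝ} (hk : Continuous k)
    {G : Torus × ℝ → ℝ} (hG : Integrable G (cylinderMeasure T)) :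
    Integrable (fun z : Torus × ℝ => torusConv k (fun y => G (y, z.2)) z.1)
      (cylinderMeasure T) := by
  obtain ⟨C, -, hC⟩ := hk.exists_abs_le_torus
  have h1 : Integrable (fun t => ∫ y, |G (y, t)|) (volume.restrict (Ioo 0 T)) :=
    integrable_integral_slice hG.abs
  have h2 : Integrable (fun z : Torus × ℝ => C * ∫ y, |G (y, z.2)|) (cylinderMeasure T) :=
    (h1.comp_snd (volume : Measure Torus)).const_mul C
  refine h2.mono' (aestronglyMeasurable_torusConv hk hG.aestronglyMeasurable) ?_
  have h3 : ∀ᵐ t ∂(volume.restrict (Ioo 0 T)), Integrable (fun y => G (y, t)) volume :=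
    hG.prod_left_ae
  filter_upwards [Measure.quasiMeasurePreserving_snd.ae h3] with z hz
  exact abs_torusConv_le hC hz z.1

/-- For the mollified density, apply the chain rule in time at each `x`, integrate over the cylinder
and integrate by parts in `x`; then remove the mollification. The set `S` has to contain the values
of the mollifications as well, since `F` is controlled only there. -/
theorem energy_identity {T τ : ℝ} {ρ ρx G : Torus × ℝ → ℝ} {ρ₀ : Torus → ℝ}
    (hC : MemCL2 T ρ) (hρ₀ : MemLp ρ₀ 2 volume)
    (hx : MemL2H1 T (fun z => oneDet τ z.2 * ρ z) ρx) (hG : MemLp G 2 (cylinderMeasure T))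
    (hGd : ∀ z, oneDet τ z.2 = 0 → G z = 0)
    (hid : ∀ ψ, TorusSmooth ψ → ∀ t ∈ Icc 0 T, ∫ x, ρ (x, t) * ψ x = (∫ x, ρ₀ x * ψ x)
      + 2 * ∫ s in (0 : ℝ)..t, ∫ x, G (x, s) * torusDeriv ψ x)
    {S : Set ℝ} (hSc : Convex ℝ S)
    (hS : ∀ t ∈ Icc 0 T, ∀ n x, torusConv (torusKernel n) (fun y => ρ (y, t)) x ∈ S)
    (hS' : ∀ t ∈ Icc 0 T, ∀ᵐ x, ρ (x, t) ∈ S) (hS₀ : ∀ᵐ x, ρ₀ x ∈ S)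
    {F F' F'' : ℝ → ℝ} {L M : ℝ} (hFm : Measurable F) (hFm' : Measurable F')
    (hF : ∀ r ∈ S, HasDerivAt F (F' r) r) (hF' : ∀ r ∈ S, HasDerivAt F' (F'' r) r)
    (hFc : ContinuousOn F'' S) (hL : ∀ r ∈ S, |F' r| ≤ L) (hM : ∀ r ∈ S, |F'' r| ≤ M)
    {t : ℝ} (ht : t ∈ Icc 0 T) :
    Integrable (fun x => F (ρ (x, t))) volume ∧
    ∫ x, F (ρ (x, t)) = (∫ x, F (ρ₀ x))
      + ∫ s in Ioo 0 t, 2 * ∫ x, F'' (ρ (x, s)) * (ρx (x, s) * G (x, s)) := by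
  have hT : (0 : ℝ) ≤ T := ht.1.trans ht.2
  have hρm : ∀ s ∈ Icc 0 T, MemLp (fun y => ρ (y, s)) 2 volume := hC.2.1
  have hρi : ∀ s ∈ Icc 0 T, Integrable (fun y => ρ (y, s)) volume :=
    fun s hs => (hρm s hs).integrable (by norm_num)
  have hGi : Integrable G (cylinderMeasure T) := hG.integrable (by norm_num)
  have hle := cylinderMeasure_mono ht.2
  have hsub : Ioo 0 t ⊆ Ioo 0 T := Ioo_subset_Ioo_right ht.2
  have aesub : ∀ {p : ℝ → Prop}, (∀ᵐ s ∂(volume.restrict (Ioo 0 T)), p s) →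
      ∀ᵐ s ∂(volume.restrict (Ioo 0 t)), p s := fun h => ae_restrict_of_ae_restrict_of_subset hsub h
  have hLip := fun r hr s hs => abs_sub_le_of_hasDerivAt hSc hF hL (r := r) (s := s) hr hs
  have aeG := aesub (ae_memLp_slice hG)
  have aex := aesub (ae_memLp_slice hx.2.1)
  have aew := aesub hx.2.2
  have aet : ∀ᵐ s ∂(volume.restrict (Ioo 0 t)), s ∈ Icc 0 T :=
    (ae_restrict_mem measurableSet_Ioo).mono fun s hs => Ioo_subset_Icc_self (hsub hs)
  -- Testing with `y ↦ torusKernel n (x - y)` exhibits the mollified density at each fixed `x` as a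
  -- primitive in time.
  have hR : ∀ n x, ∀ s ∈ Icc 0 T, torusConv (torusKernel n) (fun y => ρ (y, s)) x
      = torusConv (torusKernel n) ρ₀ x + ∫ r in (0 : ℝ)..s,
        -2 * torusConv (torusDeriv (torusKernel n)) (fun y => G (y, r)) x := fun n x s hs => by
    have h1 := hid _ ((torusSmooth_torusKernel n).comp_const_sub x) s hs
    rw [(torusSmooth_torusKernel n).torusDeriv_comp_const_sub x] at h1
    simp only [mul_neg, integral_neg, intervalIntegral.integral_neg] at h1
    rw [intervalIntegral.integral_const_mul]
    simp only [torusConv, mul_comm (torusKernel n _), mul_comm (torusDeriv (torusKernel n) _)]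
    rw [h1]
    ring
  have hS₀' : ∀ n x, torusConv (torusKernel n) ρ₀ x ∈ S := fun n x => by
    have h1 := hR n x 0 ⟨le_rfl, hT⟩
    rw [intervalIntegral.integral_same, add_zero] at h1
    rw [← h1]
    exact hS 0 ⟨le_rfl, hT⟩ n x
  obtain ⟨i1, i1n, t1⟩ := tendsto_integral_comp_torusConv (hρm t ht) (hS t ht) (hS' t ht)
    (Φ := F) (L := L) (hFm.comp_aemeasurable (hρm t ht).1.aemeasurable).aestronglyMeasurable hLip
  obtain ⟨-, i2n, t2⟩ := tendsto_integral_comp_torusConv hρ₀ hS₀' hS₀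
    (Φ := F) (L := L) (hFm.comp_aemeasurable hρ₀.1.aemeasurable).aestronglyMeasurable hLip
  have key : ∀ n, AEStronglyMeasurable (fun s => 2 * ∫ x,
        F'' (torusConv (torusKernel n) (fun y => ρ (y, s)) x)
          * (torusConv (torusKernel n) (fun y => ρx (y, s)) x
            * torusConv (torusKernel n) (fun y => G (y, s)) x)) (volume.restrict (Ioo 0 t)) ∧
      (∫ x, F (torusConv (torusKernel n) (fun y => ρ (y, t)) x))
        - (∫ x, F (torusConv (torusKernel n) ρ₀ x))
      = ∫ s in Ioo 0 t, 2 * ∫ x, F'' (torusConv (torusKernel n) (fun y => ρ (y, s)) x)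
          * (torusConv (torusKernel n) (fun y => ρx (y, s)) x
            * torusConv (torusKernel n) (fun y => G (y, s)) x) := fun n => by
    have hks := torusSmooth_torusKernel n
    have hkc := continuous_torusKernel n
    have hkd := hks.continuous_torusDeriv
    have hβ := (integrable_torusConv_cylinder hkd hGi).const_mul (-2)
    have hβt := hβ.mono_measure hle
    have hΓ : Integrable (fun z : Torus × ℝ => F' (torusConv (torusKernel n) (fun y => ρ (y, z.2)) z.1)
        * (-2 * torusConv (torusDeriv (torusKernel n)) (fun y => G (y, z.2)) z.1))
        (cylinderMeasure t) := by
      refine hβt.bdd_mul (c := L) ?_ ?_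
      · exact (hFm'.comp_aemeasurable ((aestronglyMeasurable_torusConv hkc
          hC.1).mono_measure hle).aemeasurable).aestronglyMeasurable
      · filter_upwards [ae_cylinder_time_mem t] with z hz
        exact hL _ (hS z.2 (Ioo_subset_Icc_self (hsub hz)) n z.1)
    have h1 : (∫ x, F (torusConv (torusKernel n) (fun y => ρ (y, t)) x))
        - (∫ x, F (torusConv (torusKernel n) ρ₀ x))
        = ∫ x, ∫ s in Ioo 0 t, F' (torusConv (torusKernel n) (fun y => ρ (y, s)) x)
        * (-2 * torusConv (torusDeriv (torusKernel n)) (fun y => G (y, s)) x) := by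
      rw [← integral_sub (i1n n) (i2n n)]
      refine integral_congr_ae ?_
      have hb : ∀ᵐ x : Torus, Integrable (fun s => -2 * torusConv (torusDeriv (torusKernel n))
        (fun y => G (y, s)) x) (volume.restrict (Ioo 0 t)) := hβt.prod_right_ae
      filter_upwards [hb] with x hbx
      rw [comp_primitive_sub_eq_integral ht.1
        ((intervalIntegrable_iff_integrableOn_Ioo_of_le ht.1).2 hbx)
        (R := fun s => torusConv (torusKernel n) (fun y => ρ (y, s)) x)
        (fun s hs => hR n x s ⟨hs.1, hs.2.trans ht.2⟩) hSc hF hL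
        (fun s hs => hS s ⟨hs.1, hs.2.trans ht.2⟩ n x),
        intervalIntegral.integral_of_le ht.1, integral_Ioc_eq_integral_Ioo]
    have h2 : (fun s => ∫ x, F' (torusConv (torusKernel n) (fun y => ρ (y, s)) x)
        * (-2 * torusConv (torusDeriv (torusKernel n)) (fun y => G (y, s)) x))
        =ᵐ[volume.restrict (Ioo 0 t)] fun s => 2 * ∫ x,
        F'' (torusConv (torusKernel n) (fun y => ρ (y, s)) x)
          * (torusConv (torusKernel n) (fun y => ρx (y, s)) x
            * torusConv (torusKernel n) (fun y => G (y, s)) x) := by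
      filter_upwards [aeG, aew, aet] with s hs1 hs2 hs3
      have hGs : Integrable (fun y => G (y, s)) volume := hs1.integrable (by norm_num)
      have d1 := hasTorusDeriv_torusConv hks hGs
      have d0 := hasTorusDeriv_torusConv hks (hρi s hs3)
      have d2 := d0.comp (F := F') (F' := F'') fun x => hF' _ (hS s hs3 n x)
      have c1 := continuous_torusConv hkd hGs
      have c2 := (hFc.comp_continuous d0.continuous (hS s hs3 n)).mul
        (continuous_torusConv hkd (hρi s hs3))
      have h3 := d2.integral_mul_eq d1 c2 c1
      have h4 : ∀ x : Torus, F' (torusConv (torusKernel n) (fun y => ρ (y, s)) x)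
        * (-2 * torusConv (torusDeriv (torusKernel n)) (fun y => G (y, s)) x)
        = -2 * (F' (torusConv (torusKernel n) (fun y => ρ (y, s)) x)
          * torusConv (torusDeriv (torusKernel n)) (fun y => G (y, s)) x) := fun x => by ring
      simp only [h4]
      rw [integral_const_mul, h3, neg_mul_neg]
      congr 1
      refine integral_congr_ae (Eventually.of_forall fun x => ?_)
      dsimp only
      rw [mul_assoc]
      congr 1
      -- `ρ(·, s)` has a known weak derivative only when `1_det = 1`; at the other times the flux
      -- vanishes, so both sides are zero.
      rcases oneDet_eq_zero_or_one τ s with hd | hd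
      · have : ∀ y, G (y, s) = 0 := fun y => hGd (y, s) hd
        simp [this, torusConv]
      · simp only [hd, one_mul] at hs2
        rw [hs2.torusConv_torusDeriv hks]
    have h3 : AEStronglyMeasurable (fun s => ∫ x, F' (torusConv (torusKernel n) (fun y => ρ (y, s)) x)
        * (-2 * torusConv (torusDeriv (torusKernel n)) (fun y => G (y, s)) x))
        (volume.restrict (Ioo 0 t)) := hΓ.integral_prod_right.aestronglyMeasurable
    refine ⟨h3.congr h2, ?_⟩
    rw [h1, integral_integral_swap hΓ]
    exact integral_congr_ae h2
  -- A dominating function independent of `n`: `|a b| ≤ a² + b²` combined with the `L²` contraction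
  -- of mollification.
  have hdom : Integrable (fun s => 2 * (M * ((∫ x, ρx (x, s) ^ 2) + ∫ x, G (x, s) ^ 2)))
      (volume.restrict (Ioo 0 t)) := by
    have j1 : IntegrableOn _ (Ioo 0 T) volume := integrable_integral_slice hx.2.1.integrable_sq
    have j2 : IntegrableOn _ (Ioo 0 T) volume := integrable_integral_slice hG.integrable_sq
    exact (((j1.mono_set hsub).add (j2.mono_set hsub)).const_mul M).const_mul 2
  have t3 : Tendsto (fun n => ∫ s in Ioo 0 t, 2 * ∫ x,
        F'' (torusConv (torusKernel n) (fun y => ρ (y, s)) x)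
          * (torusConv (torusKernel n) (fun y => ρx (y, s)) x
            * torusConv (torusKernel n) (fun y => G (y, s)) x)) atTop
      (𝓝 (∫ s in Ioo 0 t, 2 * ∫ x, F'' (ρ (x, s)) * (ρx (x, s) * G (x, s)))) := by
    refine tendsto_integral_of_dominated_convergence _ (fun n => (key n).1) hdom (fun n => ?_) ?_
    · filter_upwards [aeG, aex, aet] with s hs1 hs2 hs3
      have hkc := continuous_torusKernel n
      have m1 := memLp_torusConv hkc (hs1.integrable (by norm_num)) 2
      have m2 := memLp_torusConv hkc (hs2.integrable (by norm_num)) 2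
      have q1 := integral_sq_torusConv_le hkc (torusKernel_nonneg n) (integral_torusKernel n) hs1
      have q2 := integral_sq_torusConv_le hkc (torusKernel_nonneg n) (integral_torusKernel n) hs2
      have hM0 : 0 ≤ M := (abs_nonneg _).trans (hM _ (hS s hs3 0 0))
      rw [norm_mul, Real.norm_ofNat]
      refine mul_le_mul_of_nonneg_left ?_ zero_le_two
      have q3 : M * ((∫ x, torusConv (torusKernel n) (fun y => ρx (y, s)) x ^ 2)
          + ∫ x, torusConv (torusKernel n) (fun y => G (y, s)) x ^ 2)
          ≤ M * ((∫ x, ρx (x, s) ^ 2) + ∫ x, G (x, s) ^ 2) :=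
        mul_le_mul_of_nonneg_left (add_le_add q2 q1) hM0
      refine le_trans ?_ q3
      rw [← integral_add m2.integrable_sq m1.integrable_sq, ← integral_const_mul]
      refine norm_integral_le_of_norm_le ((m2.integrable_sq.add m1.integrable_sq).const_mul M)
        (Eventually.of_forall fun x => ?_)
      rw [norm_mul]
      refine mul_le_mul (hM _ (hS s hs3 n x)) ?_ (norm_nonneg _) hM0
      rw [norm_mul, Real.norm_eq_abs, Real.norm_eq_abs]
      rw [← sq_abs (torusConv _ _ x), ← sq_abs (torusConv (torusKernel n) (fun y => G (y, s)) x)]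
      nlinarith [sq_nonneg (|torusConv (torusKernel n) (fun y => ρx (y, s)) x|
        - |torusConv (torusKernel n) (fun y => G (y, s)) x|), sq_nonneg
        (|torusConv (torusKernel n) (fun y => ρx (y, s)) x|), sq_nonneg
        (|torusConv (torusKernel n) (fun y => G (y, s)) x|)]
    · filter_upwards [aeG, aex, aet] with s hs1 hs2 hs3
      refine Tendsto.const_mul 2 (tendsto_integral_comp_mul
        (fun n => continuous_torusConv (continuous_torusKernel n) (hρi s hs3)) (hρi s hs3)
        (tendsto_integral_abs_torusConv (hρm s hs3)) (fun n => ?_) (hs2.integrable_mul hs1)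
        (tendsto_integral_abs_torusConv_mul hs2 hs1) (hS s hs3) (hS' s hs3) hFc hM)
      exact (memLp_torusConv (continuous_torusKernel n) (hs2.integrable (by norm_num)) 2).integrable_mul
        (memLp_torusConv (continuous_torusKernel n) (hs1.integrable (by norm_num)) 2)
  refine ⟨i1, ?_⟩
  have h5 := tendsto_nhds_unique ((t1.sub t2).congr fun n => (key n).2) t3
  linarith

/-! ### Integrability of the flux and the entropy inequality -/

theorem ae_cylinder_of_forall_slice {T : ℝ} {ρ : Torus × ℝ → ℝ} {S : Set ℝ} (hS : MeasurableSet S)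
    (hm : AEStronglyMeasurable ρ (cylinderMeasure T)) (h : ∀ t ∈ Icc 0 T, ∀ᵐ x, ρ (x, t) ∈ S) :
    ∀ᵐ z ∂(cylinderMeasure T), ρ z ∈ S := by
  -- Fubini for null sets requires a measurable set, hence a strongly measurable representative of
  -- `ρ`.
  obtain ⟨ρ', hρ', hae⟩ := hm
  have h1 : ∀ᵐ t ∂(volume.restrict (Ioo 0 T)), ∀ᵐ x, ρ' (x, t) ∈ S := by
    filter_upwards [swap_ae_cylinder hae, ae_restrict_mem measurableSet_Ioo] with t ht1 ht2
    filter_upwards [ht1, h t (Ioo_subset_Icc_self ht2)] with x hx1 hx2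
    rwa [← hx1]
  have hm' : MeasurableSet {z : ℝ × Torus | ρ' z.swap ∈ S} :=
    (hρ'.measurable.comp measurable_swap) hS
  have h2 : ∀ᵐ z ∂((volume.restrict (Ioo 0 T)).prod (volume : Measure Torus)), ρ' z.swap ∈ S :=
    (Measure.ae_prod_iff_ae_ae hm').2 h1
  have h3 : ∀ᵐ z ∂(cylinderMeasure T), ρ' z ∈ S := by
    have := (Measure.measurePreserving_swap (μ := (volume : Measure Torus))
      (ν := volume.restrict (Ioo 0 T))).quasiMeasurePreserving.ae h2
    simp only [Prod.swap_swap] at this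
    exact this
  filter_upwards [hae, h3] with z h4 h5
  rwa [h4]

/-- Interpolation between `L^∞(L²)` and `L²(H¹)`: at almost every time `sup f² ≤ 2 (‖f‖² + ‖f_x‖²)`
by the Sobolev inequality, hence `∫ f⁴ ≤ sup f² · M`, which is integrable in time. -/
theorem memLp_four_oneDet_mul {T τ : ℝ} {ρ ρx : Torus × ℝ → ℝ} (hC : MemCL2 T ρ)
    (hx : MemL2H1 T (fun z => oneDet τ z.2 * ρ z) ρx) :
    MemLp (fun z => oneDet τ z.2 * ρ z) 4 (cylinderMeasure T) := by
  obtain ⟨M, hM0, hM⟩ := hC.exists_integral_sq_le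
  set f : Torus × ℝ → ℝ := fun z => oneDet τ z.2 * ρ z with hf
  have hslice : ∀ᵐ t ∂(volume.restrict (Ioo 0 T)), Integrable (fun x => f (x, t) ^ 4) volume ∧
      ∫ x, f (x, t) ^ 4 ≤ 2 * ((∫ x, f (x, t) ^ 2) + ∫ x, ρx (x, t) ^ 2) * M := by
    filter_upwards [ae_memLp_slice hx.1, ae_memLp_slice hx.2.1, hx.2.2,
      ae_restrict_mem measurableSet_Ioo] with t h1 h2 h3 ht
    have h4 := h3.ae_abs_comp_le h1 h2 convex_univ (fun _ _ => mem_univ _)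
      (Eventually.of_forall fun _ => mem_univ _) (W := fun r => r) (W' := fun _ => 1) (L := 1)
      h1.1 (fun r _ => hasDerivAt_id r) continuousOn_const (by simp)
    have h5 := integral_abs_le_sqrt h1
    have h6 := integral_abs_le_sqrt h2
    set A := ∫ x, f (x, t) ^ 2
    set B := ∫ x, ρx (x, t) ^ 2
    have hA : 0 ≤ A := integral_nonneg fun x => sq_nonneg _
    have hB : 0 ≤ B := integral_nonneg fun x => sq_nonneg _
    have h7 : ∀ᵐ x, f (x, t) ^ 2 ≤ 2 * (A + B) := by
      filter_upwards [h4] with x hx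
      simp only [abs_one, one_mul] at hx
      have h8 : |f (x, t)| ≤ √A + √B := hx.trans (add_le_add h5 h6)
      have h9 : f (x, t) ^ 2 ≤ (√A + √B) ^ 2 := by
        rw [← sq_abs]
        exact pow_le_pow_left₀ (abs_nonneg _) h8 2
      have := Real.sq_sqrt hA
      have := Real.sq_sqrt hB
      nlinarith [sq_nonneg (√A - √B)]
    have h8 : ∀ᵐ x, f (x, t) ^ 4 ≤ 2 * (A + B) * f (x, t) ^ 2 := by
      filter_upwards [h7] with x hx
      calc f (x, t) ^ 4 = f (x, t) ^ 2 * f (x, t) ^ 2 := by ring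
        _ ≤ _ := mul_le_mul_of_nonneg_right hx (sq_nonneg _)
    have h9 : Integrable (fun x => f (x, t) ^ 4) volume := by
      refine (h1.integrable_sq.const_mul (2 * (A + B))).mono' (h1.1.pow 4) ?_
      filter_upwards [h8] with x hx
      rwa [Real.norm_eq_abs, abs_of_nonneg (by positivity)]
    refine ⟨h9, ?_⟩
    have h10 := integral_mono_ae h9 (h1.integrable_sq.const_mul (2 * (A + B))) h8
    rw [integral_const_mul] at h10
    refine h10.trans (mul_le_mul_of_nonneg_left ?_ (by positivity))
    have hρ := hC.2.1 t (Ioo_subset_Icc_self ht)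
    refine (integral_mono h1.integrable_sq hρ.integrable_sq fun x => ?_).trans
      (hM t (Ioo_subset_Icc_self ht))
    rcases oneDet_eq_zero_or_one τ t with hd | hd
    · simp [hf, hd, sq_nonneg]
    · simp [hf, hd]
  have hm : AEStronglyMeasurable (fun z => f z ^ 4) (cylinderMeasure T) := hx.1.1.pow 4
  have hI : Integrable (fun z => f z ^ 4) (cylinderMeasure T) := by
    refine (integrable_prod_iff' hm).2 ⟨hslice.mono fun t ht => ht.1, ?_⟩
    have j1 : Integrable _ (volume.restrict (Ioo 0 T)) := integrable_integral_slice hx.1.integrable_sq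
    have j2 : Integrable _ (volume.restrict (Ioo 0 T)) := integrable_integral_slice hx.2.1.integrable_sq
    refine (((j1.add j2).const_mul 2).mul_const M).mono' hm.prod_swap.norm.integral_prod_right' ?_
    filter_upwards [hslice] with t ht
    rw [Real.norm_eq_abs, abs_of_nonneg (integral_nonneg fun x => norm_nonneg _)]
    refine le_trans (le_of_eq (integral_congr_ae (Eventually.of_forall fun x => ?_))) ht.2
    change ‖f (x, t) ^ 4‖ = _
    rw [Real.norm_eq_abs, abs_of_nonneg (by positivity)]
  refine (integrable_norm_rpow_iff hx.1.1 (by norm_num) (by norm_num)).1 ?_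
  refine hI.congr (Eventually.of_forall fun z => ?_)
  have h4 : (4 : ENNReal).toReal = ((4 : ℕ) : ℝ) := by norm_num
  change f z ^ 4 = ‖f z‖ ^ (4 : ENNReal).toReal
  rw [h4, Real.rpow_natCast, Real.norm_eq_abs, Even.pow_abs (by decide)]

/-- The consequences of the definition of a generalized solution that enter the energy estimates. -/
structure IsRegularSolution (T τ : ℝ) (u : Torus × ℝ → ℝ) (ρ₀ : Torus → ℝ)
    (ρ ρx : Torus × ℝ → ℝ) : Prop where
  memCL2 : MemCL2 T ρ
  memLp_init : MemLp ρ₀ 2 volume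
  memL2H1 : MemL2H1 T (fun z => oneDet τ z.2 * ρ z) ρx
  memLp_mul : MemLp (fun z => oneDet τ z.2 * (ρ z * u z)) 2 (cylinderMeasure T)
  memLp_flux : MemLp (fun z => oneDet τ z.2 * (ρ z * u z - ρx z)) 2 (cylinderMeasure T)
  weak : ∀ ψ, TorusSmooth ψ → ∀ t ∈ Icc 0 T, ∫ x, ρ (x, t) * ψ x = (∫ x, ρ₀ x * ψ x)
      + 2 * ∫ s in (0 : ℝ)..t, ∫ x, oneDet τ s * (ρ (x, s) * u (x, s) - ρx (x, s)) * torusDeriv ψ x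

theorem memLp_oneDet_mul {T τ : ℝ} {f : Torus × ℝ → ℝ} {p : ENNReal}
    (hf : MemLp f p (cylinderMeasure T)) :
    MemLp (fun z => oneDet τ z.2 * f z) p (cylinderMeasure T) := by
  refine hf.of_le (((measurable_oneDet τ).comp measurable_snd).aestronglyMeasurable.mul hf.1)
    (Eventually.of_forall fun z => ?_)
  rw [norm_mul]
  exact mul_le_of_le_one_left (norm_nonneg _) (abs_oneDet_le τ z.2)

/-- The product of `u ∈ L⁴` and `1_det ρ ∈ L⁴` is in `L²`. This makes the flux square integrable, as
the fixed-time formulation requires. -/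
theorem IsGeneralizedSolution.exists_isRegularSolution {T τ : ℝ} (hT : 0 < T)
    {u : Torus × ℝ → ℝ} {ρ₀ : Torus → ℝ} {ρ : Torus × ℝ → ℝ}
    (h : IsGeneralizedSolution T τ u ρ₀ ρ) (hu : MemLp u 4 (cylinderMeasure T))
    (hρ₀ : MemLp ρ₀ 2 volume) : ∃ ρx, IsRegularSolution T τ u ρ₀ ρ ρx := by
  obtain ⟨hC, ρx, hx, hw⟩ := h
  have : ENNReal.HolderTriple 4 4 2 := ⟨by
    have h4 : (4 : ENNReal) = 2 * 2 := by norm_num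
    rw [h4, ENNReal.mul_inv (by norm_num) (by norm_num), ← mul_add, ENNReal.inv_two_add_inv_two,
      mul_one]⟩
  have h1 : MemLp (fun z => oneDet τ z.2 * (ρ z * u z)) 2 (cylinderMeasure T) := by
    have := MemLp.mul (r := 2) hu (memLp_four_oneDet_mul hC hx)
    refine this.ae_eq (Eventually.of_forall fun z => ?_)
    simp only [Pi.mul_apply]
    ring
  have h2 : MemLp (fun z => oneDet τ z.2 * (ρ z * u z - ρx z)) 2 (cylinderMeasure T) := by
    refine (h1.sub (memLp_oneDet_mul (τ := τ) hx.2.1)).ae_eq (Eventually.of_forall fun z => ?_)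
    simp only [Pi.sub_apply]
    ring
  exact ⟨ρx, hC, hρ₀, hx, h1, h2, fun ψ hψ => integral_mul_eq_of_weak_formulation hT hC h2 hw hψ⟩

/-- A convex `C²` function on `S` with bounded derivatives. -/
structure IsEntropy (S : Set ℝ) (F F' F'' : ℝ → ℝ) : Prop where
  convex : Convex ℝ S
  measurableSet : MeasurableSet S
  measurable : Measurable F
  measurable_deriv : Measurable F'
  measurable_deriv2 : Measurable F''
  hasDerivAt : ∀ r ∈ S, HasDerivAt F (F' r) r
  hasDerivAt_deriv : ∀ r ∈ S, HasDerivAt F' (F'' r) r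
  continuousOn : ContinuousOn F'' S
  bdd : ∃ L, ∀ r ∈ S, |F' r| ≤ L
  bdd2 : ∃ M, ∀ r ∈ S, |F'' r| ≤ M
  nonneg : ∀ r ∈ S, 0 ≤ F'' r

/-- The functions `ρ₀` and `ρ(t)` and the mollifications of `ρ(t)` have values in `S`. -/
structure HasValuesIn (T : ℝ) (ρ₀ : Torus → ℝ) (ρ : Torus × ℝ → ℝ) (S : Set ℝ) : Prop where
  init : ∀ᵐ x, ρ₀ x ∈ S
  slice : ∀ t ∈ Icc 0 T, ∀ᵐ x, ρ (x, t) ∈ S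
  conv : ∀ t ∈ Icc 0 T, ∀ n x, torusConv (torusKernel n) (fun y => ρ (y, t)) x ∈ S

namespace IsRegularSolution

variable {T τ : ℝ} {u ρ ρx : Torus × ℝ → ℝ} {ρ₀ : Torus → ℝ} {S : Set ℝ} {F F' F'' : ℝ → ℝ}

theorem aestronglyMeasurable_comp (h : IsRegularSolution T τ u ρ₀ ρ ρx) {Φ : ℝ → ℝ}
    (hΦ : Measurable Φ) : AEStronglyMeasurable (fun z => Φ (ρ z)) (cylinderMeasure T) :=
  (hΦ.comp_aemeasurable h.memCL2.1.aemeasurable).aestronglyMeasurable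

theorem integrable_entropy_mul (h : IsRegularSolution T τ u ρ₀ ρ ρx) (hF : IsEntropy S F F' F'')
    (hS : HasValuesIn T ρ₀ ρ S) {g : Torus × ℝ → ℝ} (hg : Integrable g (cylinderMeasure T)) :
    Integrable (fun z => F'' (ρ z) * g z) (cylinderMeasure T) := by
  obtain ⟨M, hM⟩ := hF.bdd2
  refine hg.bdd_mul (c := M) (h.aestronglyMeasurable_comp hF.measurable_deriv2) ?_
  filter_upwards [ae_cylinder_of_forall_slice hF.measurableSet h.memCL2.1 hS.slice] with z hz
  exact hM _ hz

/-- Complete the square in the entropy identity: `(ρ u)² - ρx² - 2 ρx (ρ u - ρx) = (ρ u - ρx)² ≥ 0`,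
with weight `F'' ≥ 0`. -/
theorem energy_inequality (h : IsRegularSolution T τ u ρ₀ ρ ρx) (hF : IsEntropy S F F' F'')
    (hS : HasValuesIn T ρ₀ ρ S) {t : ℝ} (ht : t ∈ Icc 0 T) :
    Integrable (fun x => F (ρ (x, t))) volume ∧
    (∫ x, F (ρ (x, t))) + (∫ z, F'' (ρ z) * (oneDet τ z.2 * ρx z ^ 2) ∂(cylinderMeasure t))
      ≤ (∫ x, F (ρ₀ x)) + ∫ z, F'' (ρ z) * (oneDet τ z.2 * (ρ z * u z) ^ 2) ∂(cylinderMeasure T) := by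
  obtain ⟨L, hL⟩ := hF.bdd
  obtain ⟨M, hM⟩ := hF.bdd2
  have hle := cylinderMeasure_mono ht.2
  obtain ⟨h1, h2⟩ := energy_identity h.memCL2 h.memLp_init h.memL2H1 h.memLp_flux
    (fun z hz => by simp [hz]) h.weak hF.convex hS.conv hS.slice hS.init hF.measurable
    hF.measurable_deriv hF.hasDerivAt hF.hasDerivAt_deriv hF.continuousOn hL hM ht
  refine ⟨h1, ?_⟩
  have i1 := h.integrable_entropy_mul hF hS (h.memL2H1.2.1.integrable_mul h.memLp_flux)
  have i2 : Integrable (fun z => F'' (ρ z) * (oneDet τ z.2 * ρx z ^ 2)) (cylinderMeasure T) := by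
    refine h.integrable_entropy_mul hF hS ((memLp_oneDet_mul (τ := τ) h.memL2H1.2.1).integrable_sq.congr
      (Eventually.of_forall fun z => ?_))
    dsimp only
    rw [mul_pow, pow_two (oneDet τ z.2), oneDet_mul_self]
  have i3 : Integrable (fun z => F'' (ρ z) * (oneDet τ z.2 * (ρ z * u z) ^ 2))
      (cylinderMeasure T) := by
    refine h.integrable_entropy_mul hF hS (h.memLp_mul.integrable_sq.congr
      (Eventually.of_forall fun z => ?_))
    dsimp only
    rw [mul_pow (oneDet τ z.2), pow_two (oneDet τ z.2), oneDet_mul_self]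
  have e1 : ∫ s in Ioo 0 t, 2 * ∫ x, F'' (ρ (x, s)) * (ρx (x, s)
        * (oneDet τ s * (ρ (x, s) * u (x, s) - ρx (x, s))))
      = ∫ z, 2 * (F'' (ρ z) * (ρx z * (oneDet τ z.2 * (ρ z * u z - ρx z))))
        ∂(cylinderMeasure t) := by
    have i4 := (i1.mono_measure hle).const_mul 2
    have := cylinder_integral_eq i4
    simp only [integral_const_mul] at this ⊢
    exact this.symm
  have hae : ∀ᵐ z ∂(cylinderMeasure t), ρ z ∈ S :=
    ae_mono hle (ae_cylinder_of_forall_slice hF.measurableSet h.memCL2.1 hS.slice)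
  have h3 := integral_mono_ae ((i1.mono_measure hle).const_mul 2)
    ((i3.mono_measure hle).sub (i2.mono_measure hle)) (by
      filter_upwards [hae] with z hz
      have h4 := hF.nonneg _ hz
      simp only [Pi.sub_apply, Pi.mul_apply]
      rcases oneDet_eq_zero_or_one τ z.2 with hd | hd
      · simp [hd]
      · rw [hd]
        nlinarith [mul_nonneg h4 (sq_nonneg (ρ z * u z - ρx z))])
  -- The drift term is nonnegative, so it may be enlarged to the whole cylinder; the bound is then
  -- uniform in `t`.
  have h5 := integral_mono_measure hle (f := fun z => F'' (ρ z) * (oneDet τ z.2 * (ρ z * u z) ^ 2))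
    (by
      filter_upwards [ae_cylinder_of_forall_slice hF.measurableSet h.memCL2.1 hS.slice] with z hz
      have h4 := hF.nonneg _ hz
      refine mul_nonneg h4 (mul_nonneg ?_ (sq_nonneg _))
      rcases oneDet_eq_zero_or_one τ z.2 with hd | hd <;> simp [hd]) i3
  rw [integral_sub' (i3.mono_measure hle) (i2.mono_measure hle)] at h3
  rw [h2, e1]
  simp only [Pi.mul_apply] at h3
  linarith

end IsRegularSolution

/-! ### Nonnegativity of solutions -/

/-- A smooth convex approximation of the negative part. -/
theorem isEntropy_sqrt {ε : ℝ} (hε : 0 < ε) :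
    IsEntropy univ (fun r => (√(r ^ 2 + ε ^ 2) - r) / 2) (fun r => (r / √(r ^ 2 + ε ^ 2) - 1) / 2)
      (fun r => ε ^ 2 / (2 * √(r ^ 2 + ε ^ 2) ^ 3)) := by
  have hpos : ∀ r : ℝ, 0 < r ^ 2 + ε ^ 2 := fun r => by positivity
  have hsq : ∀ r : ℝ, √(r ^ 2 + ε ^ 2) ^ 2 = r ^ 2 + ε ^ 2 := fun r => Real.sq_sqrt (hpos r).le
  have hs : ∀ r : ℝ, 0 < √(r ^ 2 + ε ^ 2) := fun r => Real.sqrt_pos.2 (hpos r)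
  have hd : ∀ r : ℝ, HasDerivAt (fun r : ℝ => √(r ^ 2 + ε ^ 2)) (r / √(r ^ 2 + ε ^ 2)) r := fun r => by
    have h1 := (((hasDerivAt_id r).pow 2).add_const (ε ^ 2)).sqrt (hpos r).ne'
    convert! h1 using 1
    simp only [id, Nat.cast_ofNat, Nat.add_one_sub_one, pow_one, mul_one, Pi.pow_apply]
    rw [mul_div_mul_left _ _ two_ne_zero]
  have hcont : Continuous fun r : ℝ => ε ^ 2 / (2 * √(r ^ 2 + ε ^ 2) ^ 3) := by
    refine continuous_const.div (by fun_prop) fun r => ?_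
    have := hs r
    positivity
  refine ⟨convex_univ, MeasurableSet.univ, by fun_prop, by fun_prop, hcont.measurable,
    fun r _ => ((hd r).sub (hasDerivAt_id r)).div_const 2, fun r _ => ?_, hcont.continuousOn,
    ⟨1, fun r _ => ?_⟩, ⟨1 / (2 * ε), fun r _ => ?_⟩, fun r _ => ?_⟩
  · have h1 := (((hasDerivAt_id r).div (hd r) (hs r).ne').sub_const 1).div_const 2
    convert! h1 using 1
    simp only [id]
    have := hs r
    field_simp
    rw [hsq]
    ring
  · have h1 : |r| ≤ √(r ^ 2 + ε ^ 2) := Real.abs_le_sqrt (by nlinarith [sq_nonneg ε])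
    have h2 : |r / √(r ^ 2 + ε ^ 2)| ≤ 1 := by
      rw [abs_div, abs_of_pos (hs r)]
      exact (div_le_one (hs r)).2 h1
    rw [abs_le] at h2 ⊢
    constructor <;> linarith [h2.1, h2.2]
  · have := hs r
    rw [abs_of_nonneg (by positivity), div_le_div_iff₀ (by positivity) (by positivity)]
    have h1 : ε ≤ √(r ^ 2 + ε ^ 2) := Real.le_sqrt_of_sq_le (by nlinarith [sq_nonneg r])
    have h2 : ε ^ 3 ≤ √(r ^ 2 + ε ^ 2) ^ 3 := pow_le_pow_left₀ hε.le h1 3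
    nlinarith
  · have := hs r
    positivity

/-- The drift contributes `F''(ρ) ρ² u²`. The factor `ε` gained here makes this term vanish in the
limit with only `u ∈ L²`. -/
theorem sqrt_entropy_deriv2_mul_sq_le {ε : ℝ} (hε : 0 < ε) (r : ℝ) :
    ε ^ 2 / (2 * √(r ^ 2 + ε ^ 2) ^ 3) * r ^ 2 ≤ ε / 2 := by
  have hpos : 0 < r ^ 2 + ε ^ 2 := by positivity
  have hs : 0 < √(r ^ 2 + ε ^ 2) := Real.sqrt_pos.2 hpos
  have hsq : √(r ^ 2 + ε ^ 2) ^ 2 = r ^ 2 + ε ^ 2 := Real.sq_sqrt hpos.le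
  have h1 : ε ≤ √(r ^ 2 + ε ^ 2) := Real.le_sqrt_of_sq_le (by nlinarith [sq_nonneg r])
  set s := √(r ^ 2 + ε ^ 2)
  rw [div_mul_eq_mul_div, div_le_div_iff₀ (by positivity) two_pos]
  have h2 : r ^ 2 ≤ s ^ 2 := by nlinarith [sq_nonneg ε]
  have h3 : ε * r ^ 2 ≤ s * s ^ 2 := mul_le_mul h1 h2 (sq_nonneg _) hs.le
  nlinarith

/-- The entropy dominates the negative part and is at most `ε / 2` on the initial datum, so the
integral of the negative part is `O(ε)`. -/
theorem IsRegularSolution.ae_nonneg {T τ : ℝ} {u ρ ρx : Torus × ℝ → ℝ} {ρ₀ : Torus → ℝ}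
    (h : IsRegularSolution T τ u ρ₀ ρ ρx) (hu : MemLp u 2 (cylinderMeasure T))
    (h₀ : ∀ᵐ x, 0 ≤ ρ₀ x) {t : ℝ} (ht : t ∈ Icc 0 T) : ∀ᵐ x, 0 ≤ ρ (x, t) := by
  set U := ∫ z, u z ^ 2 ∂(cylinderMeasure T)
  have hS : HasValuesIn T ρ₀ ρ univ :=
    ⟨by simp, fun t _ => by simp, fun t _ n x => mem_univ _⟩
  have hρt := (h.memCL2.2.1 t ht).integrable one_le_two
  have hneg : Integrable (fun x => max (- ρ (x, t)) 0) volume := hρt.neg.pos_part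
  have key : ∀ ε : ℝ, 0 < ε → ∫ x, max (- ρ (x, t)) 0 ≤ ε * ((1 + U) / 2) := fun ε hε => by
    have hF := isEntropy_sqrt hε
    obtain ⟨h1, h2⟩ := h.energy_inequality hF hS ht
    have h3 : ∫ x, max (- ρ (x, t)) 0 ≤ ∫ x, (√(ρ (x, t) ^ 2 + ε ^ 2) - ρ (x, t)) / 2 := by
      refine integral_mono hneg h1 fun x => ?_
      have h4 : |ρ (x, t)| ≤ √(ρ (x, t) ^ 2 + ε ^ 2) :=
        Real.abs_le_sqrt (by nlinarith [sq_nonneg ε])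
      have h5 := abs_le.1 h4
      refine max_le ?_ ?_
      · linarith [neg_abs_le (ρ (x, t)), h5.1]
      · linarith [h5.2]
    have h6 : ∫ x, (√(ρ₀ x ^ 2 + ε ^ 2) - ρ₀ x) / 2 ≤ ε / 2 := by
      have : ∫ _ : Torus, ε / 2 = ε / 2 := by simp
      rw [← this]
      refine integral_mono_of_nonneg (Eventually.of_forall fun x => ?_) (integrable_const _) ?_
      · have h4 : |ρ₀ x| ≤ √(ρ₀ x ^ 2 + ε ^ 2) := Real.abs_le_sqrt (by nlinarith [sq_nonneg ε])
        have h5 := le_abs_self (ρ₀ x)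
        change 0 ≤ (√(ρ₀ x ^ 2 + ε ^ 2) - ρ₀ x) / 2
        linarith
      · filter_upwards [h₀] with x hx
        have : √(ρ₀ x ^ 2 + ε ^ 2) ≤ ρ₀ x + ε :=
          Real.sqrt_le_iff.2 ⟨by linarith, by nlinarith [mul_nonneg hx hε.le]⟩
        linarith
    have h7 : ∫ z, ε ^ 2 / (2 * √(ρ z ^ 2 + ε ^ 2) ^ 3) * (oneDet τ z.2 * (ρ z * u z) ^ 2)
        ∂(cylinderMeasure T) ≤ ε / 2 * U := by
      rw [← integral_const_mul]
      refine integral_mono_of_nonneg (Eventually.of_forall fun z => ?_)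
        (hu.integrable_sq.const_mul _) (Eventually.of_forall fun z => ?_)
      · refine mul_nonneg (hF.nonneg _ (mem_univ _)) (mul_nonneg ?_ (sq_nonneg _))
        rcases oneDet_eq_zero_or_one τ z.2 with hd | hd <;> simp [hd]
      · have h8 := mul_le_mul_of_nonneg_right (sqrt_entropy_deriv2_mul_sq_le hε (ρ z))
          (sq_nonneg (u z))
        dsimp only
        rcases oneDet_eq_zero_or_one τ z.2 with hd | hd
        · rw [hd, zero_mul, mul_zero]
          positivity
        · rw [hd, one_mul, mul_pow, ← mul_assoc]
          exact h8
    have h9 : 0 ≤ ∫ z, ε ^ 2 / (2 * √(ρ z ^ 2 + ε ^ 2) ^ 3) * (oneDet τ z.2 * ρx z ^ 2)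
        ∂(cylinderMeasure t) := by
      refine integral_nonneg fun z => mul_nonneg (hF.nonneg _ (mem_univ _))
        (mul_nonneg ?_ (sq_nonneg _))
      rcases oneDet_eq_zero_or_one τ z.2 with hd | hd <;> simp [hd]
    linarith
  have h1 : ∫ x, max (- ρ (x, t)) 0 ≤ 0 := by
    have h2 : Tendsto (fun ε : ℝ => ε * ((1 + U) / 2)) (𝓝[>] 0) (𝓝 0) := by
      have : Tendsto (fun ε : ℝ => ε * ((1 + U) / 2)) (𝓝 0) (𝓝 (0 * ((1 + U) / 2))) :=
        tendsto_id.mul_const _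
      rw [zero_mul] at this
      exact this.mono_left nhdsWithin_le_nhds
    exact ge_of_tendsto h2 (eventually_mem_nhdsWithin.mono fun ε hε => key ε hε)
  have h2 := (integral_eq_zero_iff_of_nonneg (fun x => le_max_right _ _) hneg).1
    (le_antisymm h1 (integral_nonneg fun x => le_max_right _ _))
  filter_upwards [h2] with x hx
  have h3 : - ρ (x, t) ≤ 0 := (le_max_left _ _).trans_eq hx
  linarith

theorem IsRegularSolution.hasValuesIn_Ici {T τ : ℝ} {u ρ ρx : Torus × ℝ → ℝ} {ρ₀ : Torus → ℝ}
    (h : IsRegularSolution T τ u ρ₀ ρ ρx) (hu : MemLp u 2 (cylinderMeasure T))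
    (h₀ : ∀ᵐ x, 0 ≤ ρ₀ x) : HasValuesIn T ρ₀ ρ (Ici 0) :=
  ⟨h₀, fun _ ht => h.ae_nonneg hu h₀ ht, fun t ht n x => by
    change 0 ≤ ∫ y, torusKernel n (x - y) * ρ (y, t)
    refine integral_nonneg_of_ae ?_
    filter_upwards [h.ae_nonneg hu h₀ ht] with y hy
    exact mul_nonneg (torusKernel_nonneg n _) hy⟩

/-! ### The truncated logarithm and its entropy -/

theorem hasDerivAt_max_zero_pow (n : ℕ) (s : ℝ) :
    HasDerivAt (fun s : ℝ => max s 0 ^ (n + 2)) ((n + 2) * max s 0 ^ (n + 1)) s := by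
  have hne : ∀ y : ℝ, y ≠ 0 →
      HasDerivAt (fun s : ℝ => max s 0 ^ (n + 2)) ((n + 2) * max y 0 ^ (n + 1)) y := fun y hy => by
    rcases lt_or_gt_of_ne hy with h | h
    · rw [max_eq_right h.le]
      have h1 : HasDerivAt (fun _ : ℝ => (0 : ℝ)) 0 y := hasDerivAt_const y 0
      rw [zero_pow (by simp), mul_zero]
      refine h1.congr_of_eventuallyEq ?_
      filter_upwards [Iio_mem_nhds h] with z hz
      rw [max_eq_right (le_of_lt hz), zero_pow (by simp)]
    · rw [max_eq_left h.le]
      have h1 := hasDerivAt_pow (n + 2) y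
      refine (h1.congr_of_eventuallyEq ?_).congr_deriv (by push_cast; ring_nf)
      filter_upwards [Ioi_mem_nhds h] with z hz
      rw [max_eq_left (le_of_lt hz)]
  by_cases hs : s = 0
  · subst hs
    -- At the kink the derivative is obtained as the continuous extension of the derivative on both
    -- sides; the exponent is at least two, so this extension exists.
    exact hasDerivAt_of_hasDerivAt_of_ne (g := fun s => (n + 2) * max s 0 ^ (n + 1))
      (fun y hy => hne y hy) (by fun_prop) (by fun_prop)
  · exact hne s hs

/-- The truncated logarithm `(- log (r + δ) - k)₊`. -/
def logTrunc (δ k r : ℝ) : ℝ := max (- Real.log (r + δ) - k) 0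

/-- The weight `1 + (- log (r + δ) - k)` on the set where the truncated logarithm is positive. -/
def logWeight (δ k r : ℝ) : ℝ := if 0 < logTrunc δ k r then 1 + logTrunc δ k r else 0

section logTrunc

variable {δ k r : ℝ}

theorem logTrunc_nonneg (δ k r : ℝ) : 0 ≤ logTrunc δ k r := le_max_right _ _

theorem measurable_logTrunc (δ k : ℝ) : Measurable (logTrunc δ k) := by
  unfold logTrunc
  fun_prop

theorem measurable_logWeight (δ k : ℝ) : Measurable (logWeight δ k) :=
  Measurable.ite (measurableSet_lt measurable_const (measurable_logTrunc δ k))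
    ((measurable_logTrunc δ k).const_add 1) measurable_const

theorem logTrunc_le (hδ : 0 < δ) (hr : 0 ≤ r) : logTrunc δ k r ≤ max (- Real.log δ - k) 0 := by
  refine max_le_max ?_ le_rfl
  have := Real.log_le_log hδ (by linarith : δ ≤ r + δ)
  linarith

theorem logWeight_nonneg (δ k r : ℝ) : 0 ≤ logWeight δ k r := by
  unfold logWeight
  split_ifs with h
  · linarith
  · exact le_rfl

theorem logWeight_le (δ k r : ℝ) : logWeight δ k r ≤ 1 + logTrunc δ k r := by
  unfold logWeight
  split_ifs with h
  · exact le_rfl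
  · linarith [logTrunc_nonneg δ k r]

/-- On `{v > 0}` the left side is `(1 + v)² - 1`, and it vanishes elsewhere. -/
theorem two_mul_add_sq_le_logWeight_sq (δ k r : ℝ) :
    2 * logTrunc δ k r + logTrunc δ k r ^ 2 ≤ logWeight δ k r ^ 2 := by
  unfold logWeight
  split_ifs with h
  · nlinarith
  · have : logTrunc δ k r = 0 := le_antisymm (not_lt.1 h) (logTrunc_nonneg δ k r)
    simp [this]

theorem logTrunc_antitone (δ r : ℝ) {k h : ℝ} (hk : k ≤ h) : logTrunc δ h r ≤ logTrunc δ k r :=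
  max_le_max (by linarith) le_rfl

theorem logWeight_antitone (δ r : ℝ) {k h : ℝ} (hk : k ≤ h) : logWeight δ h r ≤ logWeight δ k r := by
  have h1 := logTrunc_antitone δ r hk
  by_cases h2 : 0 < logTrunc δ h r
  · rw [logWeight, logWeight, if_pos h2, if_pos (h2.trans_le h1)]
    linarith
  · rw [logWeight, if_neg h2]
    exact logWeight_nonneg δ k r

/-- A Chebyshev-type bound. With `w = logTrunc δ h r > 0` and `d = h - k`, the truncation at level
`k` is exactly `w + d`. Its sixth power dominates both `d⁶` and `d³ w³`, which bounds the two terms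
of `(1 + w)³ ≤ 4 (1 + w³)`. -/
theorem logWeight_pow_three_le (δ r : ℝ) {k h : ℝ} (hk : k < h) :
    logWeight δ h r ^ 3 ≤ 4 * (1 / (h - k) ^ 6 + 1 / (h - k) ^ 3) * logTrunc δ k r ^ 6 := by
  have hd : 0 < h - k := sub_pos.2 hk
  by_cases h2 : 0 < logTrunc δ h r
  · rw [logWeight, if_pos h2]
    have e : logTrunc δ k r = logTrunc δ h r + (h - k) := by
      have h3 : 0 < - Real.log (r + δ) - h := by
        by_contra h4
        rw [logTrunc, max_eq_right (not_lt.1 h4)] at h2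
        exact lt_irrefl _ h2
      rw [logTrunc, logTrunc, max_eq_left h3.le, max_eq_left (by linarith)]
      ring
    rw [e]
    set w := logTrunc δ h r
    set d := h - k
    have h3 : (1 + w) ^ 3 ≤ 4 * (1 + w ^ 3) := by nlinarith [mul_nonneg (by linarith : 0 ≤ 1 + w) (sq_nonneg (1 - w))]
    have h4 : d ^ 6 ≤ (w + d) ^ 6 := pow_le_pow_left₀ hd.le (by linarith) 6
    have h5 : d ^ 3 ≤ (w + d) ^ 3 := pow_le_pow_left₀ hd.le (by linarith) 3
    have h6 : w ^ 3 ≤ (w + d) ^ 3 := pow_le_pow_left₀ h2.le (by linarith) 3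
    have h7 : 1 ≤ 1 / d ^ 6 * (w + d) ^ 6 := by
      rw [one_div_mul_eq_div]
      exact (one_le_div (by positivity)).2 h4
    have h8 : w ^ 3 ≤ 1 / d ^ 3 * (w + d) ^ 6 := by
      rw [one_div_mul_eq_div, le_div_iff₀ (by positivity)]
      calc w ^ 3 * d ^ 3 ≤ (w + d) ^ 3 * (w + d) ^ 3 := by gcongr
        _ = _ := by ring
    nlinarith
  · rw [logWeight, if_neg h2]
    have := logTrunc_nonneg δ k r
    rw [zero_pow three_ne_zero]
    positivity

theorem hasDerivAt_logTrunc_pow (n : ℕ) (k : ℝ) (hr : 0 < r + δ) :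
    HasDerivAt (fun r => logTrunc δ k r ^ (n + 2))
      (-((n + 2) * logTrunc δ k r ^ (n + 1) / (r + δ))) r := by
  have h1 : HasDerivAt (fun r => - Real.log (r + δ) - k) (- (1 / (r + δ))) r :=
    ((((hasDerivAt_id r).add_const δ).log hr.ne').neg).sub_const k
  have h2 := (hasDerivAt_max_zero_pow n (- Real.log (r + δ) - k)).comp r h1
  refine h2.congr_deriv ?_
  rw [logTrunc]
  ring

/-- The cube keeps the second derivative continuous where the truncation starts; a square would make
it jump. The shift `δ` keeps the derivatives bounded down to `r = 0`. -/
theorem isEntropy_logTrunc (hδ : 0 < δ) (k : ℝ) :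
    IsEntropy (Ici 0) (fun r => logTrunc δ k r ^ 3 / 3) (fun r => -(logTrunc δ k r ^ 2 / (r + δ)))
      (fun r => (2 * logTrunc δ k r + logTrunc δ k r ^ 2) / (r + δ) ^ 2) := by
  have hm := measurable_logTrunc δ k
  have hpos : ∀ r ∈ Ici (0 : ℝ), 0 < r + δ := fun r hr => by
    have : 0 ≤ r := hr
    linarith
  set V := max (- Real.log δ - k) 0
  have hV : ∀ r ∈ Ici (0 : ℝ), logTrunc δ k r ≤ V := fun r hr => logTrunc_le hδ hr
  have hV0 : 0 ≤ V := le_max_right _ _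
  have hc : ContinuousOn (logTrunc δ k) (Ici 0) := by
    unfold logTrunc
    refine ContinuousOn.sup ?_ continuousOn_const
    exact ((ContinuousOn.log (by fun_prop) fun r hr => (hpos r hr).ne').neg).sub continuousOn_const
  refine ⟨convex_Ici 0, measurableSet_Ici, by fun_prop, by fun_prop, by fun_prop, fun r hr => ?_,
    fun r hr => ?_, ?_, ⟨V ^ 2 / δ, fun r hr => ?_⟩, ⟨(2 * V + V ^ 2) / δ ^ 2, fun r hr => ?_⟩,
    fun r hr => ?_⟩
  · refine ((hasDerivAt_logTrunc_pow 1 k (hpos r hr)).div_const 3).congr_deriv ?_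
    push_cast
    ring
  · have h1 := ((hasDerivAt_logTrunc_pow 0 k (hpos r hr)).div ((hasDerivAt_id r).add_const δ)
      (hpos r hr).ne').neg
    refine h1.congr_deriv ?_
    have := hpos r hr
    simp only [id]
    field_simp
    push_cast
    ring
  · exact (((continuousOn_const.mul hc).add (hc.pow 2)).div (by fun_prop) fun r hr =>
      pow_ne_zero 2 (hpos r hr).ne')
  · have h1 := hpos r hr
    have h2 : δ ≤ r + δ := by linarith [mem_Ici.1 hr]
    have h3 := logTrunc_nonneg δ k r
    rw [abs_neg, abs_of_nonneg (by positivity)]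
    gcongr
    exact hV r hr
  · have h1 := hpos r hr
    have h2 : δ ≤ r + δ := by linarith [mem_Ici.1 hr]
    have h3 := logTrunc_nonneg δ k r
    rw [abs_of_nonneg (by positivity)]
    gcongr
    · exact hV r hr
    · exact hV r hr
  · have h1 := hpos r hr
    have h3 := logTrunc_nonneg δ k r
    positivity

end logTrunc

/-! ### De Giorgi's iteration lemma -/

/-- De Giorgi's lemma on fast geometric convergence. -/
theorem exists_vanishing_level (A Z₀ : ℝ) : ∃ D : ℝ, 0 < D ∧ ∀ (Z : ℝ → ℝ) (k₀ : ℝ),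
    (∀ k, 0 ≤ Z k) → Antitone Z → Z k₀ ≤ Z₀ →
    (∀ k h, k₀ ≤ k → k < h → Z h ^ 3 ≤ A * (1 / (h - k) ^ 6 + 1 / (h - k) ^ 3) ^ 3 * Z k ^ 4) →
    Z (k₀ + D) = 0 := by
  set a := |A| + 1
  set z := |Z₀| + 1
  have ha : 1 ≤ a := by simp [a]
  have hz : 1 ≤ z := by simp [z]
  -- Chosen so that `64⁻⁹ D = 128³ a z`; with `1 ≤ D ≤ D ^ 9` this closes the induction below.
  set D : ℝ := 128 ^ 3 * 64 ^ 9 * a * z with hD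
  have hD1 : 1 ≤ D := by
    have : 1 ≤ a * z := one_le_mul_of_one_le_of_one_le ha hz
    rw [hD, mul_assoc]
    linarith
  have hD0 : 0 < D := by linarith
  refine ⟨D, hD0, fun Z k₀ hZ hmono hZ₀ hrec => ?_⟩
  -- Levels increasing to `k₀ + D` with gaps `D / 2 ^ (j + 1)`; the sixth power of the gap produces
  -- the factor `64 ^ (j + 1)`.
  set κ : ℕ → ℝ := fun j => k₀ + D * (1 - (1 / 2) ^ j) with hκ
  have hstep : ∀ j, Z (κ (j + 1)) ^ 3 ≤ a * (2 * 64 ^ (j + 1) / D ^ 3) ^ 3 * Z (κ j) ^ 4 := fun j => by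
    have e : κ (j + 1) - κ j = D / 2 ^ (j + 1) := by
      simp only [hκ]
      rw [pow_succ (1 / 2 : ℝ), pow_succ (2 : ℝ), one_div, inv_pow]
      field_simp
      ring
    have hlt : κ j < κ (j + 1) := by
      rw [← sub_pos, e]
      positivity
    have hk : k₀ ≤ κ j := by
      have : (1 / 2 : ℝ) ^ j ≤ 1 := pow_le_one₀ (by norm_num) (by norm_num)
      simp only [hκ]
      nlinarith
    have h1 := hrec _ _ hk hlt
    rw [e] at h1
    refine h1.trans ?_
    have hA : A ≤ a := (le_abs_self A).trans (by simp [a])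
    have h2 : 1 / (D / 2 ^ (j + 1)) ^ 6 + 1 / (D / 2 ^ (j + 1)) ^ 3 ≤ 2 * 64 ^ (j + 1) / D ^ 3 := by
      have e1 : 1 / (D / 2 ^ (j + 1)) ^ 6 = 64 ^ (j + 1) / D ^ 6 := by
        rw [div_pow, one_div_div, ← pow_mul, mul_comm (j + 1) 6, pow_mul]
        norm_num
      have e2 : 1 / (D / 2 ^ (j + 1)) ^ 3 = 8 ^ (j + 1) / D ^ 3 := by
        rw [div_pow, one_div_div, ← pow_mul, mul_comm (j + 1) 3, pow_mul]
        norm_num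
      rw [e1, e2]
      have h3 : (64 : ℝ) ^ (j + 1) / D ^ 6 ≤ 64 ^ (j + 1) / D ^ 3 := by
        gcongr
        norm_num
      have h4 : (8 : ℝ) ^ (j + 1) / D ^ 3 ≤ 64 ^ (j + 1) / D ^ 3 := by
        gcongr
        norm_num
      rw [mul_div_assoc]
      linarith
    have h5 : 0 ≤ 1 / (D / 2 ^ (j + 1)) ^ 6 + 1 / (D / 2 ^ (j + 1)) ^ 3 := by positivity
    have h6 := hZ (κ j)
    gcongr
  -- The recursion loses a factor `64 ^ (3 j)`, while passing from the third to the fourth power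
  -- gains `q ^ j`; this ratio makes the two cancel.
  set q : ℝ := (1 / 64) ^ 3 with hq
  have hind : ∀ j, Z (κ j) ≤ z * q ^ j := fun j => by
    induction j with
    | zero =>
      have : κ 0 = k₀ := by simp [hκ]
      rw [this, pow_zero, mul_one]
      exact hZ₀.trans ((le_abs_self _).trans (by simp [z]))
    | succ j ih =>
      have hz0 : 0 ≤ z := by linarith
      have ha0 : 0 ≤ a := by linarith
      refine le_of_pow_le_pow_left₀ (n := 3) three_ne_zero (by positivity) ?_
      refine (hstep j).trans ?_
      have h1 : Z (κ j) ^ 4 ≤ (z * q ^ j) ^ 4 := pow_le_pow_left₀ (hZ _) ih 4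
      refine (mul_le_mul_of_nonneg_left h1 (by positivity)).trans ?_
      have hq' : (64 : ℝ) ^ 3 * q = 1 := by norm_num [hq]
      have hqj : ((64 : ℝ) ^ 3) ^ j * q ^ j = 1 := by rw [← mul_pow, hq', one_pow]
      have e1 : a * (2 * 64 ^ (j + 1) / D ^ 3) ^ 3 * (z * q ^ j) ^ 4
          = (a * 128 ^ 3 * z / D ^ 9) * z ^ 3 * (q ^ j) ^ 3 * (((64 : ℝ) ^ 3) ^ j * q ^ j) := by
        rw [pow_succ (64 : ℝ) j, ← pow_mul (64 : ℝ) 3 j, mul_comm 3 j, pow_mul]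
        field_simp
        ring
      have e2 : (z * q ^ (j + 1)) ^ 3 = (1 / 64) ^ 9 * z ^ 3 * (q ^ j) ^ 3 := by
        rw [pow_succ q j, hq]
        ring
      rw [e1, hqj, mul_one, e2]
      have h2 : a * 128 ^ 3 * z / D ^ 9 ≤ (1 / 64) ^ 9 := by
        rw [div_le_iff₀ (by positivity)]
        have h3 : D ≤ D ^ 9 := le_self_pow₀ hD1 (by norm_num)
        have h4 : (1 / 64 : ℝ) ^ 9 * D = a * 128 ^ 3 * z := by
          rw [hD]
          ring
        rw [← h4]
        gcongr
      gcongr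
  have hlim : Tendsto (fun j : ℕ => z * q ^ j) atTop (𝓝 0) := by
    have := (tendsto_pow_atTop_nhds_zero_of_lt_one (r := q) (by norm_num [hq])
      (by norm_num [hq])).const_mul z
    rwa [mul_zero] at this
  refine le_antisymm (ge_of_tendsto' hlim fun j => ?_) (hZ _)
  refine (hmono ?_).trans (hind j)
  have : (0 : ℝ) ≤ (1 / 2) ^ j := by positivity
  simp only [hκ]
  nlinarith

/-! ### Level estimates for the truncated logarithm -/

theorem oneDet_nonneg (τ t : ℝ) : 0 ≤ oneDet τ t := by
  rcases oneDet_eq_zero_or_one τ t with h | h <;> simp [h]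

/-- A form of Hölder's inequality with exponents `3` and `3 / 2`. -/
theorem integral_mul_pow_three_le {α : Type*} [MeasurableSpace α] {μ : Measure α} [IsFiniteMeasure μ]
    {f g : α → ℝ} (hf : MemLp f 6 μ) (hg : AEStronglyMeasurable g μ) {C : ℝ}
    (hg0 : ∀ x, 0 ≤ g x) (hC : ∀ᵐ x ∂μ, g x ≤ C) :
    (∫ x, f x ^ 2 * g x ^ 2 ∂μ) ^ 3 ≤ (∫ x, f x ^ 6 ∂μ) * (∫ x, g x ^ 3 ∂μ) ^ 2 := by
  have hpq : (3 : ℝ).HolderConjugate (3 / 2) := by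
    rw [Real.holderConjugate_iff]
    norm_num
  have hf2 : MemLp (fun x => f x ^ 2) (ENNReal.ofReal 3) μ := by
    have h1 := hf.norm_rpow_div 2
    have e : (6 : ENNReal) / 2 = ENNReal.ofReal 3 := by
      rw [ENNReal.ofReal_ofNat]
      rw [show (6 : ENNReal) = 3 * 2 by norm_num,
        ENNReal.mul_div_cancel_right (by norm_num) (by norm_num)]
    rw [e] at h1
    refine h1.ae_eq (Eventually.of_forall fun x => ?_)
    simp
  have hg2 : MemLp (fun x => g x ^ 2) (ENNReal.ofReal (3 / 2)) μ := by
    refine MemLp.of_bound (hg.pow 2) (C ^ 2) ?_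
    filter_upwards [hC] with x hx
    rw [Real.norm_eq_abs, abs_of_nonneg (sq_nonneg _)]
    exact pow_le_pow_left₀ (hg0 x) hx 2
  have h := integral_mul_le_Lp_mul_Lq_of_nonneg hpq
    (Eventually.of_forall fun x => sq_nonneg (f x)) (Eventually.of_forall fun x => sq_nonneg (g x))
    hf2 hg2
  have e1 : ∀ x, (f x ^ 2) ^ (3 : ℝ) = f x ^ 6 := fun x => by
    have : (3 : ℝ) = ((3 : ℕ) : ℝ) := by norm_num
    rw [this, Real.rpow_natCast]
    ring
  have e2 : ∀ x, (g x ^ 2) ^ (3 / 2 : ℝ) = g x ^ 3 := fun x => by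
    rw [← Real.rpow_natCast, ← Real.rpow_mul (hg0 x), ← Real.rpow_natCast]
    norm_num
  simp only [e1, e2] at h
  have hU : 0 ≤ ∫ x, f x ^ 6 ∂μ := integral_nonneg fun x => by positivity
  have hZ : 0 ≤ ∫ x, g x ^ 3 ∂μ := integral_nonneg fun x => pow_nonneg (hg0 x) 3
  have h0 : 0 ≤ ∫ x, f x ^ 2 * g x ^ 2 ∂μ := integral_nonneg fun x => by positivity
  refine (pow_le_pow_left₀ h0 h 3).trans_eq ?_
  rw [mul_pow, ← Real.rpow_natCast, ← Real.rpow_natCast, ← Real.rpow_mul hU, ← Real.rpow_mul hZ,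
    ← Real.rpow_natCast (∫ x, g x ^ 3 ∂μ)]
  norm_num

namespace IsRegularSolution

variable {T τ : ℝ} {u ρ ρx : Torus × ℝ → ℝ} {ρ₀ : Torus → ℝ}

theorem ae_nonneg_cylinder (h : IsRegularSolution T τ u ρ₀ ρ ρx)
    (hS : HasValuesIn T ρ₀ ρ (Ici 0)) : ∀ᵐ z ∂(cylinderMeasure T), 0 ≤ ρ z :=
  ae_cylinder_of_forall_slice measurableSet_Ici h.memCL2.1 hS.slice

theorem integrable_comp_mul (h : IsRegularSolution T τ u ρ₀ ρ ρx)
    (hS : HasValuesIn T ρ₀ ρ (Ici 0)) {Φ : ℝ → ℝ} (hΦ : Measurable Φ) {C : ℝ}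
    (hC : ∀ r, 0 ≤ r → |Φ r| ≤ C) {g : Torus × ℝ → ℝ} (hg : Integrable g (cylinderMeasure T)) :
    Integrable (fun z => g z * Φ (ρ z)) (cylinderMeasure T) := by
  refine hg.mul_bdd (c := C) (h.aestronglyMeasurable_comp hΦ) ?_
  filter_upwards [h.ae_nonneg_cylinder hS] with z hz
  exact hC _ hz

theorem integrable_oneDet (T τ : ℝ) :
    Integrable (fun z : Torus × ℝ => oneDet τ z.2) (cylinderMeasure T) := by
  have := (memLp_oneDet_mul (τ := τ) (memLp_const (p := 1) (μ := cylinderMeasure T) (1 : ℝ)))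
  simpa using this.integrable le_rfl

variable {δ k c₀ : ℝ}

theorem abs_logTrunc_pow_le (hδ : 0 < δ) (k : ℝ) (n : ℕ) (r : ℝ) (hr : 0 ≤ r) :
    |logTrunc δ k r ^ n| ≤ (max (- Real.log δ - k) 0) ^ n := by
  have h0 := logTrunc_nonneg δ k r
  rw [abs_of_nonneg (by positivity)]
  exact pow_le_pow_left₀ h0 (logTrunc_le hδ hr) n

theorem abs_logWeight_pow_le (hδ : 0 < δ) (k : ℝ) (n : ℕ) (r : ℝ) (hr : 0 ≤ r) :
    |logWeight δ k r ^ n| ≤ (1 + max (- Real.log δ - k) 0) ^ n := by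
  have h0 := logWeight_nonneg δ k r
  rw [abs_of_nonneg (by positivity)]
  refine pow_le_pow_left₀ h0 ((logWeight_le δ k r).trans ?_) n
  have := logTrunc_le (k := k) hδ hr
  linarith

theorem integrable_logTrunc_pow (h : IsRegularSolution T τ u ρ₀ ρ ρx)
    (hS : HasValuesIn T ρ₀ ρ (Ici 0)) (hδ : 0 < δ) (k : ℝ) (n : ℕ) :
    Integrable (fun z => oneDet τ z.2 * logTrunc δ k (ρ z) ^ n) (cylinderMeasure T) :=
  h.integrable_comp_mul hS ((measurable_logTrunc δ k).pow_const n) (abs_logTrunc_pow_le hδ k n)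
    (integrable_oneDet T τ)

theorem integrable_logWeight_pow (h : IsRegularSolution T τ u ρ₀ ρ ρx)
    (hS : HasValuesIn T ρ₀ ρ (Ici 0)) (hδ : 0 < δ) (k : ℝ) (n : ℕ) :
    Integrable (fun z => oneDet τ z.2 * logWeight δ k (ρ z) ^ n) (cylinderMeasure T) :=
  h.integrable_comp_mul hS ((measurable_logWeight δ k).pow_const n) (abs_logWeight_pow_le hδ k n)
    (integrable_oneDet T τ)

/-- For `k ≥ - log c₀` the truncation vanishes on the initial datum, and `ρ² / (ρ + δ)² ≤ 1` removes
the density from the drift term. The entropy and the dissipation are then each bounded by what is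
left. -/
theorem entropy_estimates (h : IsRegularSolution T τ u ρ₀ ρ ρx)
    (hS : HasValuesIn T ρ₀ ρ (Ici 0)) (hT : 0 ≤ T) (hu : MemLp u 2 (cylinderMeasure T)) (hδ : 0 < δ)
    (hc₀ : 0 < c₀) (h₀ : ∀ᵐ x, c₀ ≤ ρ₀ x) (hk : - Real.log c₀ ≤ k) :
    (∀ t ∈ Icc 0 T, Integrable (fun x => logTrunc δ k (ρ (x, t)) ^ 3) volume ∧
      ∫ x, logTrunc δ k (ρ (x, t)) ^ 3
        ≤ 3 * ∫ z, oneDet τ z.2 * (u z ^ 2 * logWeight δ k (ρ z) ^ 2) ∂(cylinderMeasure T)) ∧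
    ∫ z, (2 * logTrunc δ k (ρ z) + logTrunc δ k (ρ z) ^ 2) / (ρ z + δ) ^ 2
        * (oneDet τ z.2 * ρx z ^ 2) ∂(cylinderMeasure T)
      ≤ ∫ z, oneDet τ z.2 * (u z ^ 2 * logWeight δ k (ρ z) ^ 2) ∂(cylinderMeasure T) := by
  have hF := isEntropy_logTrunc hδ k
  set P := ∫ z, oneDet τ z.2 * (u z ^ 2 * logWeight δ k (ρ z) ^ 2) ∂(cylinderMeasure T)
  have hF0 : ∀ r, 0 ≤ (2 * logTrunc δ k r + logTrunc δ k r ^ 2) / (r + δ) ^ 2 := fun r => by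
    have := logTrunc_nonneg δ k r
    positivity
  have hinit : ∫ x, logTrunc δ k (ρ₀ x) ^ 3 / 3 = 0 := by
    refine integral_eq_zero_of_ae ?_
    filter_upwards [h₀] with x hx
    have h1 : Real.log c₀ ≤ Real.log (ρ₀ x + δ) := Real.log_le_log hc₀ (by linarith)
    have h2 : logTrunc δ k (ρ₀ x) = 0 := max_eq_right (by linarith)
    simp [h2]
  have hP : ∫ z, (2 * logTrunc δ k (ρ z) + logTrunc δ k (ρ z) ^ 2) / (ρ z + δ) ^ 2
      * (oneDet τ z.2 * (ρ z * u z) ^ 2) ∂(cylinderMeasure T) ≤ P := by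
    refine integral_mono_of_nonneg (Eventually.of_forall fun z => mul_nonneg (hF0 _)
      (mul_nonneg (oneDet_nonneg _ _) (sq_nonneg _))) ?_ ?_
    · have := h.integrable_comp_mul hS ((measurable_logWeight δ k).pow_const 2)
        (abs_logWeight_pow_le hδ k 2) (memLp_oneDet_mul (τ := τ) hu).integrable_sq
      refine this.congr (Eventually.of_forall fun z => ?_)
      dsimp only
      rw [mul_pow, pow_two (oneDet τ z.2), oneDet_mul_self, mul_assoc]
    · filter_upwards [h.ae_nonneg_cylinder hS] with z hz
      have h1 := two_mul_add_sq_le_logWeight_sq δ k (ρ z)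
      have h2 : ρ z ^ 2 / (ρ z + δ) ^ 2 ≤ 1 :=
        div_le_one_of_le₀ (pow_le_pow_left₀ hz (by linarith) 2) (sq_nonneg _)
      have h3 := oneDet_nonneg τ z.2
      have h4 : 0 ≤ 2 * logTrunc δ k (ρ z) + logTrunc δ k (ρ z) ^ 2 := by
        have := logTrunc_nonneg δ k (ρ z)
        positivity
      calc (2 * logTrunc δ k (ρ z) + logTrunc δ k (ρ z) ^ 2) / (ρ z + δ) ^ 2
            * (oneDet τ z.2 * (ρ z * u z) ^ 2)
          = oneDet τ z.2 * (u z ^ 2 * ((2 * logTrunc δ k (ρ z) + logTrunc δ k (ρ z) ^ 2)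
            * (ρ z ^ 2 / (ρ z + δ) ^ 2))) := by ring
        _ ≤ oneDet τ z.2 * (u z ^ 2 * ((2 * logTrunc δ k (ρ z) + logTrunc δ k (ρ z) ^ 2) * 1)) := by
            gcongr
        _ ≤ _ := by
            rw [mul_one]
            gcongr
  refine ⟨fun t ht => ?_, ?_⟩
  · obtain ⟨h1, h2⟩ := h.energy_inequality hF hS ht
    have h3 : 0 ≤ ∫ z, (2 * logTrunc δ k (ρ z) + logTrunc δ k (ρ z) ^ 2) / (ρ z + δ) ^ 2
        * (oneDet τ z.2 * ρx z ^ 2) ∂(cylinderMeasure t) :=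
      integral_nonneg fun z => mul_nonneg (hF0 _) (mul_nonneg (oneDet_nonneg _ _) (sq_nonneg _))
    rw [hinit, integral_div] at h2
    refine ⟨(h1.const_mul 3).congr (Eventually.of_forall fun x => ?_), by linarith⟩
    dsimp only
    ring
  · obtain ⟨-, h2⟩ := h.energy_inequality hF hS ⟨hT, le_rfl⟩
    have h3 : 0 ≤ ∫ x, logTrunc δ k (ρ (x, T)) ^ 3 / 3 := integral_nonneg fun x => by
      have := logTrunc_nonneg δ k (ρ (x, T))
      dsimp only
      positivity
    rw [hinit] at h2
    linarith

/-- At almost every time with `1_det = 1`, `∫ v⁶ ≤ sup v³ · ∫ v³`. The last factor is at most `3 P`,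
and the Sobolev inequality for `v³ / 3` bounds the supremum by `P` and the dissipation, whose time
integral is again at most `P`. -/
theorem integral_logTrunc_pow_six_le (h : IsRegularSolution T τ u ρ₀ ρ ρx)
    (hS : HasValuesIn T ρ₀ ρ (Ici 0)) (hT : 0 ≤ T) (hδ : 0 < δ) (k : ℝ) {P : ℝ} (hP0 : 0 ≤ P)
    (h3 : ∀ t ∈ Icc 0 T, Integrable (fun x => logTrunc δ k (ρ (x, t)) ^ 3) volume ∧
      ∫ x, logTrunc δ k (ρ (x, t)) ^ 3 ≤ 3 * P)
    (hx : ∫ z, (2 * logTrunc δ k (ρ z) + logTrunc δ k (ρ z) ^ 2) / (ρ z + δ) ^ 2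
        * (oneDet τ z.2 * ρx z ^ 2) ∂(cylinderMeasure T) ≤ P) :
    ∫ z, oneDet τ z.2 * logTrunc δ k (ρ z) ^ 6 ∂(cylinderMeasure T) ≤ (23 * T + 3) * P ^ 2 := by
  have hF := isEntropy_logTrunc hδ k
  set E : Torus × ℝ → ℝ := fun z => (2 * logTrunc δ k (ρ z) + logTrunc δ k (ρ z) ^ 2)
    / (ρ z + δ) ^ 2 * (oneDet τ z.2 * ρx z ^ 2) with hE
  have hE0 : ∀ z, 0 ≤ E z := fun z => by
    have h1 := logTrunc_nonneg δ k (ρ z)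
    have h2 := oneDet_nonneg τ z.2
    simp only [hE]
    positivity
  have iE : Integrable E (cylinderMeasure T) := by
    refine h.integrable_entropy_mul hF hS ((memLp_oneDet_mul (τ := τ) h.memL2H1.2.1).integrable_sq.congr
      (Eventually.of_forall fun z => ?_))
    dsimp only
    rw [mul_pow, pow_two (oneDet τ z.2), oneDet_mul_self]
  have i6 := h.integrable_logTrunc_pow hS hδ k 6
  have hEs : ∀ᵐ t ∂(volume.restrict (Ioo 0 T)), Integrable (fun x => E (x, t)) volume :=
    iE.prod_left_ae
  have hslice : ∀ᵐ t ∂(volume.restrict (Ioo 0 T)), ∫ x, oneDet τ t * logTrunc δ k (ρ (x, t)) ^ 6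
      ≤ (15 / 2 * P + 3 / 4 * ∫ x, E (x, t)) * (3 * P) := by
    filter_upwards [hEs, ae_memLp_slice h.memL2H1.2.1, h.memL2H1.2.2,
      ae_restrict_mem measurableSet_Ioo] with t iEt hm hw ht
    have ht' := Ioo_subset_Icc_self ht
    have hEt : 0 ≤ ∫ x, E (x, t) := integral_nonneg fun x => hE0 _
    rcases oneDet_eq_zero_or_one τ t with hd | hd
    · simp only [hd, zero_mul, integral_zero]
      positivity
    · simp only [hd, one_mul] at hw ⊢
      obtain ⟨i3, l3⟩ := h3 t ht'
      obtain ⟨L, hL⟩ := hF.bdd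
      have hρt := h.memCL2.2.1 t ht'
      have hm1 : AEStronglyMeasurable (fun x => logTrunc δ k (ρ (x, t)) ^ 3 / 3) volume :=
        (hF.measurable.comp_aemeasurable hρt.1.aemeasurable).aestronglyMeasurable
      have hsup := hw.ae_abs_comp_le hρt hm hF.convex (hS.conv t ht') (hS.slice t ht')
        (W := fun r => logTrunc δ k r ^ 3 / 3) hm1 hF.hasDerivAt
        (fun r hr => (hF.hasDerivAt_deriv r hr).continuousAt.continuousWithinAt) hL
      have b1 : ∫ x, |logTrunc δ k (ρ (x, t)) ^ 3 / 3| ≤ P := by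
        have : ∀ x, |logTrunc δ k (ρ (x, t)) ^ 3 / 3| = logTrunc δ k (ρ (x, t)) ^ 3 / 3 := fun x =>
          abs_of_nonneg (by have := logTrunc_nonneg δ k (ρ (x, t)); positivity)
        simp only [this]
        rw [integral_div]
        linarith
      have b2 : ∫ x, |-(logTrunc δ k (ρ (x, t)) ^ 2 / (ρ (x, t) + δ))| * |ρx (x, t)|
          ≤ 1 / 2 * (3 * P) + 1 / 4 * ∫ x, E (x, t) := by
        have hle : ∫ x, |-(logTrunc δ k (ρ (x, t)) ^ 2 / (ρ (x, t) + δ))| * |ρx (x, t)|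
            ≤ ∫ x, (1 / 2 * logTrunc δ k (ρ (x, t)) ^ 3 + 1 / 4 * E (x, t)) := by
          refine integral_mono_of_nonneg (Eventually.of_forall fun x => by positivity)
            ((i3.const_mul _).add (iEt.const_mul _)) ?_
          filter_upwards [hS.slice t ht'] with x hx
          have hv := logTrunc_nonneg δ k (ρ (x, t))
          have hr : 0 < ρ (x, t) + δ := by linarith [mem_Ici.1 hx]
          simp only [hE, hd, one_mul]
          rw [abs_neg, abs_of_nonneg (by positivity)]
          set v := logTrunc δ k (ρ (x, t))
          have e1 : v ^ 2 / (ρ (x, t) + δ) * |ρx (x, t)| = v ^ 2 * (|ρx (x, t)| / (ρ (x, t) + δ)) := by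
            ring
          have e2 : (2 * v + v ^ 2) / (ρ (x, t) + δ) ^ 2 * ρx (x, t) ^ 2
              = (2 * v + v ^ 2) * (|ρx (x, t)| / (ρ (x, t) + δ)) ^ 2 := by
            rw [div_pow, sq_abs]
            ring
          rw [e1, e2]
          set p := |ρx (x, t)| / (ρ (x, t) + δ)
          -- Young's inequality in exact form: the right side minus `v² p` equals `v (v - p)² / 2 +
          -- v² p² / 4`.
          nlinarith [mul_nonneg hv (sq_nonneg (v - p)), sq_nonneg (v * p)]
        rw [integral_add (i3.const_mul _) (iEt.const_mul _), integral_const_mul,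
          integral_const_mul] at hle
        linarith
      have hsup' : ∀ᵐ x, logTrunc δ k (ρ (x, t)) ^ 3 ≤ 15 / 2 * P + 3 / 4 * ∫ x, E (x, t) := by
        filter_upwards [hsup] with x hx
        have := le_abs_self (logTrunc δ k (ρ (x, t)) ^ 3 / 3)
        linarith
      have hC0 : 0 ≤ 15 / 2 * P + 3 / 4 * ∫ x, E (x, t) := by positivity
      have h6 : ∫ x, logTrunc δ k (ρ (x, t)) ^ 6
          ≤ ∫ x, (15 / 2 * P + 3 / 4 * ∫ x, E (x, t)) * logTrunc δ k (ρ (x, t)) ^ 3 := by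
        refine integral_mono_of_nonneg (Eventually.of_forall fun x => ?_) (i3.const_mul _) ?_
        · have := logTrunc_nonneg δ k (ρ (x, t))
          dsimp only
          positivity
        · filter_upwards [hsup'] with x hx
          have hv := logTrunc_nonneg δ k (ρ (x, t))
          calc logTrunc δ k (ρ (x, t)) ^ 6
              = logTrunc δ k (ρ (x, t)) ^ 3 * logTrunc δ k (ρ (x, t)) ^ 3 := by ring
            _ ≤ _ := mul_le_mul_of_nonneg_right hx (by positivity)
      rw [integral_const_mul] at h6
      exact h6.trans (mul_le_mul_of_nonneg_left l3 hC0)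
  have iEt : IntegrableOn (fun t => ∫ x, E (x, t)) (Ioo 0 T) volume := integrable_integral_slice iE
  have i7 : IntegrableOn (fun t => (15 / 2 * P + 3 / 4 * ∫ x, E (x, t)) * (3 * P)) (Ioo 0 T) volume :=
    ((integrable_const _).add (iEt.const_mul _)).mul_const _
  have h7 := integral_mono_ae (integrable_integral_slice i6) i7 hslice
  rw [← cylinder_integral_eq i6, integral_mul_const, integral_add (integrable_const _)
    (iEt.const_mul _), integral_const_mul (3 / 4 : ℝ), ← cylinder_integral_eq iE] at h7
  simp only [integral_const, measureReal_restrict_apply_univ, Real.volume_real_Ioo_of_le hT, sub_zero,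
    smul_eq_mul] at h7
  refine h7.trans ?_
  have h8 : (T * (15 / 2 * P) + 3 / 4 * ∫ z, E z ∂(cylinderMeasure T)) * (3 * P)
      ≤ (T * (15 / 2 * P) + 3 / 4 * P) * (3 * P) := by
    gcongr
  nlinarith [mul_nonneg hT (sq_nonneg P), sq_nonneg P]

theorem integral_sq_mul_logWeight_sq_pow_three_le (h : IsRegularSolution T τ u ρ₀ ρ ρx)
    (hS : HasValuesIn T ρ₀ ρ (Ici 0)) (hu : MemLp u 6 (cylinderMeasure T)) (hδ : 0 < δ) (k : ℝ) :
    (∫ z, oneDet τ z.2 * (u z ^ 2 * logWeight δ k (ρ z) ^ 2) ∂(cylinderMeasure T)) ^ 3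
      ≤ (∫ z, u z ^ 6 ∂(cylinderMeasure T))
        * (∫ z, oneDet τ z.2 * logWeight δ k (ρ z) ^ 3 ∂(cylinderMeasure T)) ^ 2 := by
  have hg : AEStronglyMeasurable (fun z => oneDet τ z.2 * logWeight δ k (ρ z)) (cylinderMeasure T) := by
    simpa using (h.integrable_logWeight_pow hS hδ k 1).aestronglyMeasurable
  have h1 := integral_mul_pow_three_le hu hg (C := 1 + max (- Real.log δ - k) 0)
    (fun z => mul_nonneg (oneDet_nonneg _ _) (logWeight_nonneg _ _ _)) (by
      filter_upwards [h.ae_nonneg_cylinder hS] with z hz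
      have h2 := abs_logWeight_pow_le hδ k 1 (ρ z) hz
      rw [pow_one, pow_one] at h2
      have h3 := logWeight_nonneg δ k (ρ z)
      have h4 := (le_abs_self _).trans h2
      rcases oneDet_eq_zero_or_one τ z.2 with hd | hd
      · rw [hd, zero_mul]
        exact h3.trans h4
      · rwa [hd, one_mul])
  have e2 : ∀ z : Torus × ℝ, u z ^ 2 * (oneDet τ z.2 * logWeight δ k (ρ z)) ^ 2
      = oneDet τ z.2 * (u z ^ 2 * logWeight δ k (ρ z) ^ 2) := fun z => by
    rcases oneDet_eq_zero_or_one τ z.2 with hd | hd <;> simp [hd]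
  have e3 : ∀ z : Torus × ℝ, (oneDet τ z.2 * logWeight δ k (ρ z)) ^ 3
      = oneDet τ z.2 * logWeight δ k (ρ z) ^ 3 := fun z => by
    rcases oneDet_eq_zero_or_one τ z.2 with hd | hd <;> simp [hd]
  simpa only [e2, e3] using h1

/-- This starts the iteration with a bound free of `δ`. Integrating the entropy bound in time gives
`Z ≤ T (4 + 12 P)`, while `P³ ≤ U Z²`; so `Z³` is at most a constant plus a multiple of `Z²`, and
dividing by `Z²` when `Z > 1` bounds `Z`. -/
theorem integral_logWeight_pow_three_le (h : IsRegularSolution T τ u ρ₀ ρ ρx)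
    (hS : HasValuesIn T ρ₀ ρ (Ici 0)) (hT : 0 ≤ T) (hδ : 0 < δ) (k : ℝ) {P U : ℝ}
    (hU : 0 ≤ U)
    (h3 : ∀ t ∈ Icc 0 T, Integrable (fun x => logTrunc δ k (ρ (x, t)) ^ 3) volume ∧
      ∫ x, logTrunc δ k (ρ (x, t)) ^ 3 ≤ 3 * P)
    (hP : P ^ 3 ≤ U * (∫ z, oneDet τ z.2 * logWeight δ k (ρ z) ^ 3 ∂(cylinderMeasure T)) ^ 2) :
    ∫ z, oneDet τ z.2 * logWeight δ k (ρ z) ^ 3 ∂(cylinderMeasure T)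
      ≤ 1 + 256 * T ^ 3 + 6912 * T ^ 3 * U := by
  have iZ := h.integrable_logWeight_pow hS hδ k 3
  have hP0 : 0 ≤ P := by
    have h1 := (h3 0 ⟨le_rfl, hT⟩).2
    have h2 : 0 ≤ ∫ x, logTrunc δ k (ρ (x, 0)) ^ 3 := integral_nonneg fun x =>
      pow_nonneg (logTrunc_nonneg _ _ _) 3
    linarith
  set Z := ∫ z, oneDet τ z.2 * logWeight δ k (ρ z) ^ 3 ∂(cylinderMeasure T) with hZ
  have hZ0 : 0 ≤ Z := integral_nonneg fun z =>
    mul_nonneg (oneDet_nonneg _ _) (pow_nonneg (logWeight_nonneg _ _ _) 3)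
  have h1 : Z ≤ T * (4 + 12 * P) := by
    rw [hZ, cylinder_integral_eq iZ]
    have e : T * (4 + 12 * P) = ∫ _ in Ioo 0 T, (4 + 12 * P) := by
      simp [Real.volume_real_Ioo_of_le hT]
    rw [e]
    refine setIntegral_mono_on (integrable_integral_slice iZ) (integrable_const _)
      measurableSet_Ioo fun t ht => ?_
    obtain ⟨i3, l3⟩ := h3 t (Ioo_subset_Icc_self ht)
    have h4 : ∫ x, oneDet τ t * logWeight δ k (ρ (x, t)) ^ 3
        ≤ ∫ x, (4 + 4 * logTrunc δ k (ρ (x, t)) ^ 3) := by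
      refine integral_mono_of_nonneg (Eventually.of_forall fun x => mul_nonneg (oneDet_nonneg _ _)
        (pow_nonneg (logWeight_nonneg _ _ _) 3)) ((integrable_const _).add (i3.const_mul _))
        (Eventually.of_forall fun x => ?_)
      have hv := logTrunc_nonneg δ k (ρ (x, t))
      have h5 := pow_le_pow_left₀ (logWeight_nonneg δ k _) (logWeight_le δ k (ρ (x, t))) 3
      have h6 : oneDet τ t * logWeight δ k (ρ (x, t)) ^ 3 ≤ logWeight δ k (ρ (x, t)) ^ 3 :=
        mul_le_of_le_one_left (pow_nonneg (logWeight_nonneg _ _ _) 3)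
          ((le_abs_self _).trans (abs_oneDet_le _ _))
      refine (h6.trans h5).trans ?_
      set v := logTrunc δ k (ρ (x, t))
      nlinarith [mul_nonneg (by linarith : 0 ≤ 1 + v) (sq_nonneg (1 - v))]
    rw [integral_add (integrable_const _) (i3.const_mul _), integral_const_mul (4 : ℝ)] at h4
    simp only [integral_const, probReal_univ, one_smul] at h4
    exact h4.trans (by linarith)
  by_cases hZ1 : Z ≤ 1
  · have : 0 ≤ 256 * T ^ 3 + 6912 * T ^ 3 * U := by positivity
    linarith
  · have h2 : Z ^ 3 ≤ (T * (4 + 12 * P)) ^ 3 := pow_le_pow_left₀ hZ0 h1 3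
    have h4 : (4 + 12 * P) ^ 3 ≤ 256 + 6912 * P ^ 3 := by
      nlinarith [mul_nonneg (by linarith : 0 ≤ 1 + 3 * P) (sq_nonneg (1 - 3 * P))]
    have h5 : (T * (4 + 12 * P)) ^ 3 ≤ T ^ 3 * (256 + 6912 * (U * Z ^ 2)) := by
      rw [mul_pow]
      refine mul_le_mul_of_nonneg_left (h4.trans ?_) (by positivity)
      linarith
    have hZ2 : 1 ≤ Z ^ 2 := one_le_pow₀ (not_le.1 hZ1).le
    have h6 : Z ^ 2 * Z ≤ Z ^ 2 * (256 * T ^ 3 + 6912 * T ^ 3 * U) := by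
      have : T ^ 3 * 256 ≤ T ^ 3 * 256 * Z ^ 2 := le_mul_of_one_le_right (by positivity) hZ2
      nlinarith
    have h7 := le_of_mul_le_mul_left h6 (by linarith)
    linarith

/-! ### Conclusion: the uniform lower bound -/

/-- The lower bound for nonnegative solutions, with a constant that only depends on `c₀`, `T` and
a bound for the norm of `u` in `L⁶`. -/
theorem exists_lower_bound (c₀ T U : ℝ) (hc₀ : 0 < c₀) (hT : 0 < T) (hU : 0 ≤ U) :
    ∃ c : ℝ, 0 < c ∧ ∀ (τ : ℝ) (u ρ ρx : Torus × ℝ → ℝ) (ρ₀ : Torus → ℝ),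
      IsRegularSolution T τ u ρ₀ ρ ρx → MemLp u 6 (cylinderMeasure T) →
      ∫ z, u z ^ 6 ∂(cylinderMeasure T) ≤ U → (∀ᵐ x, c₀ ≤ ρ₀ x) →
      ∀ t ∈ Icc 0 T, ∀ᵐ x, c ≤ ρ (x, t) := by
  obtain ⟨D, hD, hvanish⟩ := exists_vanishing_level (64 * (23 * T + 3) ^ 3 * U ^ 2)
    (1 + 256 * T ^ 3 + 6912 * T ^ 3 * U)
  set k₀ := - Real.log c₀
  refine ⟨Real.exp (- (k₀ + D)), Real.exp_pos _, fun τ u ρ ρx ρ₀ h hu6 huU h₀ t ht => ?_⟩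
  have hu2 : MemLp u 2 (cylinderMeasure T) := hu6.mono_exponent (by norm_num)
  have hS : HasValuesIn T ρ₀ ρ (Ici 0) :=
    h.hasValuesIn_Ici hu2 (h₀.mono fun x hx => hc₀.le.trans hx)
  -- The level `k₀ + D` is fixed before `δ`, so the bound survives the limit `δ → 0`.
  have key : ∀ δ : ℝ, 0 < δ → ∀ᵐ x, Real.exp (- (k₀ + D)) ≤ ρ (x, t) + δ := fun δ hδ => by
    set P : ℝ → ℝ := fun k =>
      ∫ z, oneDet τ z.2 * (u z ^ 2 * logWeight δ k (ρ z) ^ 2) ∂(cylinderMeasure T) with hP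
    set Z : ℝ → ℝ := fun k =>
      ∫ z, oneDet τ z.2 * logWeight δ k (ρ z) ^ 3 ∂(cylinderMeasure T) with hZ
    have hP0 : ∀ k, 0 ≤ P k := fun k => integral_nonneg fun z =>
      mul_nonneg (oneDet_nonneg _ _) (mul_nonneg (sq_nonneg _) (sq_nonneg _))
    have hZ0 : ∀ k, 0 ≤ Z k := fun k => integral_nonneg fun z =>
      mul_nonneg (oneDet_nonneg _ _) (pow_nonneg (logWeight_nonneg _ _ _) 3)
    have hPZ : ∀ k, P k ^ 3 ≤ U * Z k ^ 2 := fun k =>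
      (h.integral_sq_mul_logWeight_sq_pow_three_le hS hu6 hδ k).trans
        (mul_le_mul_of_nonneg_right huU (sq_nonneg _))
    have hest := fun k (hk : k₀ ≤ k) => h.entropy_estimates hS hT.le hu2 hδ hc₀ h₀ hk
    have hanti : Antitone Z := fun k h' hk => by
      refine integral_mono (h.integrable_logWeight_pow hS hδ h' 3)
        (h.integrable_logWeight_pow hS hδ k 3) fun z => ?_
      exact mul_le_mul_of_nonneg_left (pow_le_pow_left₀ (logWeight_nonneg _ _ _)
        (logWeight_antitone δ (ρ z) hk) 3) (oneDet_nonneg _ _)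
    have hrec : ∀ k h', k₀ ≤ k → k < h' → Z h' ^ 3 ≤ 64 * (23 * T + 3) ^ 3 * U ^ 2
        * (1 / (h' - k) ^ 6 + 1 / (h' - k) ^ 3) ^ 3 * Z k ^ 4 := fun k h' hk hlt => by
      have hd : 0 < h' - k := sub_pos.2 hlt
      set s := 1 / (h' - k) ^ 6 + 1 / (h' - k) ^ 3
      have hs : 0 ≤ s := by positivity
      have hY := h.integral_logTrunc_pow_six_le hS hT.le hδ k (hP0 k) (hest k hk).1 (hest k hk).2
      have h1 : Z h' ≤ 4 * s * ∫ z, oneDet τ z.2 * logTrunc δ k (ρ z) ^ 6 ∂(cylinderMeasure T) := by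
        rw [← integral_const_mul]
        refine integral_mono (h.integrable_logWeight_pow hS hδ h' 3)
          ((h.integrable_logTrunc_pow hS hδ k 6).const_mul _) fun z => ?_
        have h2 := mul_le_mul_of_nonneg_left (logWeight_pow_three_le δ (ρ z) hlt)
          (oneDet_nonneg τ z.2)
        refine h2.trans_eq ?_
        ring
      have h2 : Z h' ≤ 4 * s * ((23 * T + 3) * P k ^ 2) :=
        h1.trans (mul_le_mul_of_nonneg_left hY (by positivity))
      calc Z h' ^ 3 ≤ (4 * s * ((23 * T + 3) * P k ^ 2)) ^ 3 := pow_le_pow_left₀ (hZ0 _) h2 3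
        _ = 64 * (23 * T + 3) ^ 3 * s ^ 3 * (P k ^ 3) ^ 2 := by ring
        _ ≤ 64 * (23 * T + 3) ^ 3 * s ^ 3 * (U * Z k ^ 2) ^ 2 := by
          have := hPZ k
          have := hP0 k
          gcongr
        _ = _ := by ring
    have hZb := h.integral_logWeight_pow_three_le hS hT.le hδ k₀ hU (hest k₀ le_rfl).1 (hPZ k₀)
    have hZ1 := hvanish Z k₀ hZ0 hanti hZb hrec
    -- `Z` sees only the times with `1_det = 1`. Passing through `P` and the entropy estimate gives
    -- the vanishing of the truncation at every time.
    have hP1 : P (k₀ + D) = 0 := by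
      have h1 := hPZ (k₀ + D)
      rw [hZ1] at h1
      have h2 : P (k₀ + D) ^ 3 = 0 :=
        le_antisymm (h1.trans_eq (by ring)) (pow_nonneg (hP0 _) 3)
      exact pow_eq_zero_iff three_ne_zero |>.1 h2
    obtain ⟨i3, l3⟩ := (hest (k₀ + D) (by linarith)).1 t ht
    change _ ≤ 3 * P (k₀ + D) at l3
    rw [hP1, mul_zero] at l3
    have hnn : ∀ x, 0 ≤ logTrunc δ (k₀ + D) (ρ (x, t)) ^ 3 := fun x =>
      pow_nonneg (logTrunc_nonneg _ _ _) 3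
    have h0 := (integral_eq_zero_iff_of_nonneg hnn i3).1 (le_antisymm l3 (integral_nonneg hnn))
    filter_upwards [h0, hS.slice t ht] with x hx hρ
    have h4 : logTrunc δ (k₀ + D) (ρ (x, t)) = 0 := pow_eq_zero_iff three_ne_zero |>.1 hx
    have h5 : - Real.log (ρ (x, t) + δ) - (k₀ + D) ≤ 0 := (le_max_left _ _).trans_eq h4
    rw [← Real.le_log_iff_exp_le (by linarith [mem_Ici.1 hρ])]
    linarith
  have h1 : ∀ᵐ x, ∀ n : ℕ, Real.exp (- (k₀ + D)) ≤ ρ (x, t) + 1 / ((n : ℝ) + 1) :=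
    ae_all_iff.2 fun n => key _ (by positivity)
  filter_upwards [h1] with x hx
  have h2 := tendsto_one_div_add_atTop_nhds_zero_nat (𝕜 := ℝ).const_add (ρ (x, t))
  rw [add_zero] at h2
  exact ge_of_tendsto' h2 hx

end IsRegularSolution

theorem theoremA2 (c₀ T m A B : ℝ) (hc₀ : 0 < c₀) (hT : 0 < T) (hm : 6 < m) :
    ∃ c : ℝ, 0 < c ∧
      ∀ (τ : ℝ) (u ux ρ : Torus × ℝ → ℝ) (ρ₀ : Torus → ℝ), 0 < τ →
        MemLp u (ENNReal.ofReal m) (cylinderMeasure T) →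
        eLpNorm u (ENNReal.ofReal m) (cylinderMeasure T) ≤ ENNReal.ofReal B →
        MemLp ρ₀ 2 volume →
        (∀ᵐ x : Torus, c₀ ≤ ρ₀ x) →
        IsGeneralizedSolution T τ u ρ₀ ρ →
        AEStronglyMeasurable ux (cylinderMeasure T) →
        HasWeakDerivX T u ux →
        Integrable (fun z => ρ z * |ux z| ^ 2) (cylinderMeasure T) →
        ∫ z, ρ z * |ux z| ^ 2 ∂(cylinderMeasure T) ≤ A →
        ∀ᵐ z ∂(cylinderMeasure T), c ≤ ρ z := by
  have h6 : (6 : ENNReal) ≤ ENNReal.ofReal m := by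
    rw [← ENNReal.ofReal_ofNat]
    exact ENNReal.ofReal_le_ofReal hm.le
  -- The bound for the `L⁶` norm of `u` given by its `L^m` bound and Hölder on a set of finite
  -- measure; it depends only on `B`, `T` and `m`.
  set N : ENNReal := ENNReal.ofReal B
    * cylinderMeasure T univ ^ (1 / (6 : ENNReal).toReal - 1 / (ENNReal.ofReal m).toReal) with hN
  have hexp : 0 ≤ 1 / (6 : ENNReal).toReal - 1 / (ENNReal.ofReal m).toReal := by
    rw [ENNReal.toReal_ofReal (by linarith), ENNReal.toReal_ofNat, sub_nonneg]
    exact one_div_le_one_div_of_le (by norm_num) hm.le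
  have hNtop : N ≠ ⊤ := ENNReal.mul_ne_top ENNReal.ofReal_ne_top
    (ENNReal.rpow_ne_top_of_nonneg hexp (measure_ne_top _ _))
  obtain ⟨c, hc, H⟩ := IsRegularSolution.exists_lower_bound c₀ T (N.toReal ^ 6) hc₀ hT (by positivity)
  refine ⟨c, hc, fun τ u ux ρ ρ₀ _ hu hB hρ₀ h₀ hsol _ _ _ _ => ?_⟩
  have hu6 : MemLp u 6 (cylinderMeasure T) := hu.mono_exponent h6
  have hu4 : MemLp u 4 (cylinderMeasure T) := hu6.mono_exponent (by norm_num)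
  obtain ⟨ρx, hreg⟩ := hsol.exists_isRegularSolution hT hu4 hρ₀
  have hnorm : eLpNorm u 6 (cylinderMeasure T) ≤ N :=
    (eLpNorm_le_eLpNorm_mul_rpow_measure_univ h6 hu.1).trans (by rw [hN]; gcongr)
  have hU : ∫ z, u z ^ 6 ∂(cylinderMeasure T) ≤ N.toReal ^ 6 := by
    have h1 := hu6.eLpNorm_eq_integral_rpow_norm (by norm_num) (by norm_num)
    have h2 : ∀ z, ‖u z‖ ^ (6 : ENNReal).toReal = u z ^ 6 := fun z => by
      have : (6 : ENNReal).toReal = ((6 : ℕ) : ℝ) := by norm_num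
      rw [this, Real.rpow_natCast, Real.norm_eq_abs, Even.pow_abs (by decide)]
    simp only [h2] at h1
    have hI : 0 ≤ ∫ z, u z ^ 6 ∂(cylinderMeasure T) := integral_nonneg fun z => by positivity
    rw [h1] at hnorm
    have h3 := (ENNReal.ofReal_le_iff_le_toReal hNtop).1 hnorm
    have h4 := pow_le_pow_left₀ (by positivity) h3 6
    rw [← Real.rpow_natCast, ← Real.rpow_mul hI] at h4
    simpa using h4
  exact ae_cylinder_of_forall_slice (S := Ici c) measurableSet_Ici hreg.memCL2.1
    (H τ u ρ ρx ρ₀ hreg hu6 hU h₀)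

end
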